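/- Let $m=(m_0,m_1,\dots)$ be a bounded sequence of integers $m_k\ge 2$, let $G_m=\prod_{k\ge 0}\mathbb Z/m_k\mathbb Z$ be the corresponding (bounded) Vilenkin group, and let $\mu$ be its normalized Haar measure, i.e. the product of the uniform probability measures on the factors. Put $M_0=1$, $M_{k+1}=m_kM_k$, write $n\in\mathbb N=\{0,1,2,\dots\}$ as $n=\sum_k n_kM_k$ with $0\le n_k<m_k$, and let $\psi_n(x)=\prod_{k} \exp(2\pi i\,n_kx_k/m_k)$ be the Vilenkin system. Let $\mathcal F_n$ be the $\sigma$-algebra generated by the sets $I_n(x)=\{y: y_i=x_i \text{ for } i<n\}$, $x\in G_m$. For $0<p<\infty$ the Hardy space $H_p$ consists of all complex-valued martingales $f=(f^{(n)})_{n\in\mathbb N}$ with respect to $(\mathcal F_n)_{n\in\mathbb N}$ such that $$\|f\|_{H_p}:=\Big(\int_{G_m}\sup_{n}|f^{(n)}|^p\,d\mu\Big)^{1/p}<\infty .$$ Put $\|g\|_{\mathrm{weak}\text{-}L_p}:=\big(\sup_{t>0}t^p\mu(|g|>t)\big)^{1/p}$. For a martingale $f$ let $\widehat f(i)=\lim_{k\to\infty}\int_{G_m}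 f^{(k)}\overline{\psi_i}\,d\mu$ and $S_nf=\sum_{k=0}^{n-1}\widehat f(k)\psi_k$. Let $(q_k)_{k\ge0}$ be a non-increasing sequence of non-negative real numbers with $q_0>0$, put $Q_n=\sum_{k=0}^{n-1}q_k$, and let $$T_nf=\frac1{Q_n}\sum_{k=0}^{n-1}q_kS_kf\quad(n\ge1),\qquad T_0f=0,\qquad T^*f=\sup_{n\in\mathbb N}|T_nf| .$$ (a) The maximal operator $T^*$ is bounded from $H_{1/2}$ to weak-$L_{1/2}$: there is a finite constant $C$ such that $\|T^*f\|_{\mathrm{weak}\text{-}L_{1/2}}\le C\,\|f\|_{H_{1/2}}$ for all $f\in H_{1/2}$. (b) Let $0<p<1/2$ and suppose that there is a constant $c>0$ such that $$\frac{q_{n+1}}{Q_{n+2}}\ge\frac cn\qquad\text{for all } n\ge 1 .$$ Then there exists a martingale $f\in H_p$ such that $$\sup_{n\in\mathbb N}\|T_nf\|_{\mathrm{weak}\text{-}L_p}=\infty .$$ -/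

import Mathlib

open MeasureTheory ProbabilityTheory Filter
open scoped ENNReal NNReal

noncomputable section

namespace Vilenkin

/-- The Vilenkin group `G_m`, the complete direct product of the groups `ℤ / m_k`. -/
abbrev G (m : ℕ → ℕ) : Type := ∀ k, ZMod (m k)

/-- The normalized Haar measure on `G_m`: the product of the uniform probability measures
on the factors. -/
def haar (m : ℕ → ℕ) : Measure (G m) :=
  Measure.infinitePi fun k => uniformOn (Set.univ : Set (ZMod (m k)))

/-- The interval `I_n(x)` of all `y` with `y_0 = x_0, …, y_{n-1} = x_{n-1}`. -/
def interval (m : ℕ → ℕ) (n : ℕ) (x : G m) : Set (G m) := {y | ∀ i < n, y i = x i}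

theorem interval_eq_iUnion (m : ℕ → ℕ) (n : ℕ) (x : G m) :
    interval m n x = ⋃ a : ZMod (m n), interval m (n + 1) (Function.update x n a) := by
  ext y
  simp only [interval, Set.mem_ofPred_eq, Set.mem_iUnion]
  constructor
  · intro h
    refine ⟨y n, fun i hi => ?_⟩
    rcases Nat.lt_succ_iff_lt_or_eq.mp hi with h' | rfl
    · rw [Function.update_of_ne h'.ne, h i h']
    · simp
  · rintro ⟨a, h⟩ i hi
    rw [h i (by omega), Function.update_of_ne hi.ne]

theorem measurableSet_interval (m : ℕ → ℕ) (n : ℕ) (x : G m) :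
    MeasurableSet (interval m n x) := by
  have h : interval m n x = ⋂ i, ⋂ (_ : i < n), (fun y : G m => y i) ⁻¹' {x i} := by
    ext y; simp [interval]
  rw [h]
  exact MeasurableSet.iInter fun i => MeasurableSet.iInter fun _ =>
    measurable_pi_apply i (measurableSet_singleton _)

/-- The filtration `(F_n)`, where `F_n` is generated by the intervals `I_n(x)`, `x ∈ G_m`. -/
def filtration (m : ℕ → ℕ) : Filtration ℕ (inferInstance : MeasurableSpace (G m)) where
  seq n := MeasurableSpace.generateFrom (Set.range (interval m n))
  mono' := by
    refine monotone_nat_of_le_succ fun n => MeasurableSpace.generateFrom_le ?_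
    rintro _ ⟨x, rfl⟩
    rw [interval_eq_iUnion]
    have : Countable (ZMod (m n)) := by
      cases h : m n
      · exact inferInstanceAs (Countable ℤ)
      · exact inferInstanceAs (Countable (Fin _))
    exact MeasurableSet.iUnion fun a =>
      MeasurableSpace.measurableSet_generateFrom ⟨_, rfl⟩
  le' n := by
    refine MeasurableSpace.generateFrom_le ?_
    rintro _ ⟨x, rfl⟩
    exact measurableSet_interval m n x

/-- The generalized powers: `M_0 = 1`, `M_{k+1} = m_k M_k`. -/
def M (m : ℕ → ℕ) : ℕ → ℕ
  | 0 => 1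
  | k + 1 => m k * M m k

/-- The `k`-th digit `n_k ∈ {0, …, m_k - 1}` in the expansion `n = ∑ n_k M_k`. -/
def digit (m : ℕ → ℕ) (n k : ℕ) : ℕ := n / M m k % m k

/-- The generalized Rademacher function `r_k(x) = exp(2πi x_k / m_k)`. -/
def rademacher (m : ℕ → ℕ) (k : ℕ) (x : G m) : ℂ :=
  Complex.exp (2 * Real.pi * Complex.I * ((x k).val : ℂ) / (m k : ℂ))

/-- The Vilenkin function `ψ_n = ∏_k r_k ^ n_k`. Since `n < 2 ^ k ≤ M_k` for `k ≥ n`, the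
digits `n_k` with `k ≥ n` vanish and the infinite product is the product over `k < n`. -/
def psi (m : ℕ → ℕ) (n : ℕ) (x : G m) : ℂ :=
  ∏ k ∈ Finset.range n, rademacher m k x ^ digit m n k

/-- The `i`-th Vilenkin-Fourier coefficient of a martingale, the limit of the `i`-th
coefficients of its members (for a martingale this sequence is eventually constant). -/
def coeff (m : ℕ → ℕ) (f : ℕ → G m → ℂ) (i : ℕ) : ℂ :=
  limUnder atTop fun k => ∫ x, f k x * (starRingEnd ℂ) (psi m i x) ∂(haar m)

/-- The partial sum `S_n f = ∑_{k<n} f̂(k) ψ_k`. -/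
def partialSum (m : ℕ → ℕ) (f : ℕ → G m → ℂ) (n : ℕ) (x : G m) : ℂ :=
  ∑ k ∈ Finset.range n, coeff m f k * psi m k x

/-- `Q_n = ∑_{k<n} q_k`. -/
def Q (q : ℕ → ℝ) (n : ℕ) : ℝ := ∑ k ∈ Finset.range n, q k

/-- The `T` mean `T_n f = Q_n⁻¹ ∑_{k<n} q_k S_k f`; here `T_0 f = 0`. -/
def tMean (m : ℕ → ℕ) (q : ℕ → ℝ) (f : ℕ → G m → ℂ) (n : ℕ) (x : G m) : ℂ :=
  (1 / (Q q n : ℂ)) * ∑ k ∈ Finset.range n, (q k : ℂ) * partialSum m f k x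

/-- The maximal operator `T* f = sup_n |T_n f|`, with values in `[0, ∞]`. -/
def tMax (m : ℕ → ℕ) (q : ℕ → ℝ) (f : ℕ → G m → ℂ) (x : G m) : ℝ≥0∞ :=
  ⨆ n, ‖tMean m q f n x‖ₑ

/-- The weak-`L_p` quasi-norm `(sup_{t > 0} t ^ p μ(|g| > t)) ^ (1 / p)`. -/
def weakNorm {ε : Type*} [ENorm ε] (m : ℕ → ℕ) (p : ℝ) (g : G m → ε) : ℝ≥0∞ :=
  (⨆ t : {t : ℝ≥0 // 0 < t}, ((t : ℝ≥0) : ℝ≥0∞) ^ p *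
    haar m {x | ((t : ℝ≥0) : ℝ≥0∞) < ‖g x‖ₑ}) ^ (1 / p)

/-- The Hardy quasi-norm `‖f*‖_p`, where `f* = sup_n |f^(n)|`. -/
def hardyNorm (m : ℕ → ℕ) (p : ℝ) (f : ℕ → G m → ℂ) : ℝ≥0∞ :=
  eLpNorm (fun x => ⨆ n, ‖f n x‖ₑ) (ENNReal.ofReal p) (haar m)

/-- Membership in the martingale Hardy space `H_p(G_m)`. -/
def MemHardy (m : ℕ → ℕ) (p : ℝ) (f : ℕ → G m → ℂ) : Prop :=
  Martingale f (filtration m) (haar m) ∧ hardyNorm m p f < ∞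

end Vilenkin

end

/-! For (a), the weights `q` are non-increasing, so Abel summation dominates every `T` mean by the
Fejér (arithmetic) means of the partial sums. It then suffices to prove the weak type estimate for
the Fejér means (`norm_sum_smul_le_of_antitone`, `sqrt_mul_haar_fejer_gt_le`).

The kernel `fejer m n`, which is `n` times the Fejér kernel, is bounded by weights `M_k M_s` on sets
where the first `s` coordinates vanish except possibly the `k`-th (`norm_fejer_le`). Consequently
the Fejér means of an atom of height `B` on an interval of rank `N` are bounded, uniformly in the
order of the mean, by a multiple of `B / M_N ^ 2` times a translated `majorant`
(`norm_integral_mul_fejer_le`). This majorant is used only after truncation at height `L`: the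
integral of `min (c * majorant) L` is `O(√(c L))`, uniformly in `N`. Since `min · L` is subadditive
on non-negative numbers, these estimates add up over arbitrary families of atoms
(`haar_le_sum_majorant`).

Atoms come from predictable stopping times at the levels `L * 4 ^ k`. With `c` of order `L 4^k /
M_j^2`, each stopping interval of rank `j` contributes `L 2^k / M_j`. The measures `1 / M_j` sum to
at most a constant times the measure of the set where the maximal function exceeds `L * 4 ^ k`, and
summing `2^k` times these measures gives the integral of the square root of the maximal function.
This is where the exponent `1/2` enters.

For (b), take a martingale whose coefficients are constant on very sparse blocks `[M_n, M_{n+1})`.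
The mean of order `M_n + 2` contains the first coefficient of the block exactly once, with relative
weight at least `c / M_n`. Coefficients of size `2^{-k} M_n^{1/p - 1}` keep the martingale in `H_p`,
but contribute `c 2^{-k} M_n^{1/p - 2}` at every point. For `p < 1/2` this is unbounded and, for
sparse blocks, outweighs all earlier coefficients. -/

noncomputable section

namespace Vilenkin

/-! ### Cylinders, finite-coordinate functions and Haar measure. -/

section Basic

variable {m : ℕ → ℕ}

theorem M_pos [∀ k, NeZero (m k)] (n : ℕ) : 0 < M m n := by
  induction n with
  | zero => simp [M]
  | succ n ih => exact Nat.mul_pos (Nat.pos_of_ne_zero (NeZero.ne _)) ih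

theorem M_succ (n : ℕ) : M m (n + 1) = m n * M m n := rfl

theorem M_eq_prod (n : ℕ) : M m n = ∏ i ∈ Finset.range n, m i := by
  induction n with
  | zero => rfl
  | succ n ih => rw [M_succ, Finset.prod_range_succ, ih, mul_comm]

theorem two_mul_M_le (hm : ∀ k, 2 ≤ m k) (n : ℕ) : 2 * M m n ≤ M m (n + 1) :=
  Nat.mul_le_mul_right _ (hm n)

theorem M_mono (hm : ∀ k, 2 ≤ m k) : Monotone (M m) :=
  monotone_nat_of_le_succ fun n => by have := two_mul_M_le hm n; omega

theorem two_pow_mul_M_le (hm : ∀ k, 2 ≤ m k) (n i : ℕ) : 2 ^ i * M m n ≤ M m (n + i) := by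
  induction i with
  | zero => simp
  | succ i ih =>
    calc 2 ^ (i + 1) * M m n = 2 * (2 ^ i * M m n) := by ring
      _ ≤ 2 * M m (n + i) := Nat.mul_le_mul_left _ ih
      _ ≤ M m (n + (i + 1)) := two_mul_M_le hm _

theorem lt_M (hm : ∀ k, 2 ≤ m k) (n : ℕ) : n < M m n := by
  have h := two_pow_mul_M_le hm 0 n
  simp only [M, mul_one, zero_add] at h
  exact n.lt_two_pow_self.trans_le h

/-- The sum of the generalized powers up to an index is dominated by twice the last one. -/
theorem sum_M_le (hm : ∀ k, 2 ≤ m k) (n : ℕ) :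
    ∑ s ∈ Finset.range (n + 1), (M m s : ℝ) ≤ 2 * M m n := by
  induction n with
  | zero => simp [M]
  | succ n ih =>
    rw [Finset.sum_range_succ]
    have : (2 * M m n : ℝ) ≤ M m (n + 1) := by exact_mod_cast two_mul_M_le hm n
    linarith

/-- The element agreeing with `x` in the first `n` coordinates and vanishing in the others. -/
def trunc (n : ℕ) (x : G m) : G m := fun i => if i < n then x i else 0

theorem trunc_apply_of_lt {n i : ℕ} (hi : i < n) (x : G m) : trunc n x i = x i := if_pos hi

theorem trunc_congr {n : ℕ} {x y : G m} (h : ∀ i < n, x i = y i) : trunc n x = trunc n y := by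
  ext i
  unfold trunc
  split_ifs with hi
  exacts [h i hi, rfl]

theorem trunc_trunc (n : ℕ) (x : G m) : trunc n (trunc n x) = trunc n x :=
  trunc_congr fun _ hi => trunc_apply_of_lt hi x

theorem finite_range_trunc [∀ k, NeZero (m k)] (n : ℕ) :
    (Set.range (trunc (m := m) n)).Finite := by
  let e : (∀ i : Fin n, ZMod (m i)) → G m := fun a i => if h : i < n then a ⟨i, h⟩ else 0
  refine (Set.finite_range e).subset ?_
  rintro _ ⟨x, rfl⟩
  refine ⟨fun i => x i, ?_⟩
  ext i
  simp only [e, trunc]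
  split_ifs <;> rfl

/-- Representatives of the intervals of rank `n`. -/
def reps (m : ℕ → ℕ) [∀ k, NeZero (m k)] (n : ℕ) : Finset (G m) :=
  (finite_range_trunc (m := m) n).toFinset

theorem mem_reps [∀ k, NeZero (m k)] {n : ℕ} {y : G m} : y ∈ reps m n ↔ trunc n y = y := by
  simp only [reps, Set.Finite.mem_toFinset, Set.mem_range]
  constructor
  · rintro ⟨x, rfl⟩
    exact trunc_trunc n x
  · exact fun h => ⟨y, h⟩

theorem trunc_mem_reps [∀ k, NeZero (m k)] (n : ℕ) (x : G m) : trunc n x ∈ reps m n :=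
  mem_reps.2 (trunc_trunc n x)

theorem mem_interval {n : ℕ} {x y : G m} : y ∈ interval m n x ↔ ∀ i < n, y i = x i := Iff.rfl

theorem mem_interval_iff_trunc_eq [∀ k, NeZero (m k)] {n : ℕ} {x y : G m} (hy : y ∈ reps m n) :
    x ∈ interval m n y ↔ trunc n x = y := by
  rw [mem_reps] at hy
  constructor
  · intro h
    rw [← hy]
    exact trunc_congr h
  · rintro rfl i hi
    exact (trunc_apply_of_lt hi x).symm

theorem measurableSet_interval_filtration (n : ℕ) (x : G m) :
    MeasurableSet[filtration m n] (interval m n x) :=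
  MeasurableSpace.measurableSet_generateFrom ⟨x, rfl⟩

/-- A set determined by the first `n` coordinates belongs to `F_n`. -/
theorem measurableSet_filtration [∀ k, NeZero (m k)] {n : ℕ} {s : Set (G m)}
    (hs : ∀ x y, (∀ i < n, x i = y i) → x ∈ s → y ∈ s) : MeasurableSet[filtration m n] s := by
  have h : s = ⋃ y ∈ {y : G m | y ∈ reps m n ∧ y ∈ s}, interval m n y := by
    ext x
    simp only [Set.mem_iUnion, exists_prop, Set.mem_ofPred_eq]
    constructor
    · intro hx
      exact ⟨trunc n x, ⟨trunc_mem_reps n x,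
        hs x _ (fun i hi => (trunc_apply_of_lt hi x).symm) hx⟩,
        fun i hi => (trunc_apply_of_lt hi x).symm⟩
    · rintro ⟨y, ⟨_, hy⟩, hxy⟩
      exact hs y x (fun i hi => (hxy i hi).symm) hy
  rw [h]
  refine MeasurableSet.biUnion ?_ fun y _ => measurableSet_interval_filtration n y
  exact ((reps m n).finite_toSet.subset fun y hy => hy.1).countable

/-- The sets of `F_n` are determined by the first `n` coordinates. -/
theorem mem_of_measurableSet_filtration {n : ℕ} {s : Set (G m)}
    (hs : MeasurableSet[filtration m n] s) {x y : G m} (hxy : ∀ i < n, x i = y i) :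
    x ∈ s ↔ y ∈ s := by
  change MeasurableSet[MeasurableSpace.generateFrom (Set.range (interval m n))] s at hs
  induction s, hs using MeasurableSpace.generateFrom_induction with
  | hC t ht _ =>
    obtain ⟨z, rfl⟩ := ht
    simp only [mem_interval]
    exact forall₂_congr fun i hi => by rw [hxy i hi]
  | empty => simp
  | compl t _ ih => simp [ih]
  | iUnion f _ ih => simp [ih]

/-- A level set of `f` lies in `F_n`, hence is a union of intervals of rank `n`. With the converse
below, measurability for `F_n` becomes an everywhere statement about coordinates, which avoids null
sets later. -/
theorem dependsOn_of_stronglyMeasurable {E : Type*} [TopologicalSpace E] [T2Space E]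
    [TopologicalSpace.PseudoMetrizableSpace E]
    {n : ℕ} {f : G m → E} (hf : StronglyMeasurable[filtration m n] f) :
    DependsOn f (Set.Iio n) := by
  intro x y hxy
  borelize E
  have h : MeasurableSet[filtration m n] (f ⁻¹' {f y}) :=
    hf.measurable (measurableSet_singleton (f y))
  exact (mem_of_measurableSet_filtration h hxy).2 rfl

theorem _root_.DependsOn.eq_trunc {α : Type*} {n : ℕ} {f : G m → α} (hf : DependsOn f (Set.Iio n))
    (x : G m) : f x = f (trunc n x) :=
  hf fun _ hi => (trunc_apply_of_lt hi x).symm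

/-- There are finitely many intervals of rank `n`, so such a function is simple. Boundedness and
integrability of everything that depends on finitely many coordinates have the same origin. -/
theorem _root_.DependsOn.stronglyMeasurable [∀ k, NeZero (m k)] {E : Type*} [TopologicalSpace E]
    {n : ℕ} {f : G m → E} (hf : DependsOn f (Set.Iio n)) :
    StronglyMeasurable[filtration m n] f := by
  let φ : @SimpleFunc (G m) (filtration m n) E :=
    @SimpleFunc.mk _ (filtration m n) _ f
      (fun e => measurableSet_filtration fun x y hxy hx => by
        simpa [← hf hxy] using hx)
      (by
        refine ((reps m n).finite_toSet.image f).subset ?_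
        rintro _ ⟨x, rfl⟩
        exact ⟨trunc n x, trunc_mem_reps n x, (hf.eq_trunc x).symm⟩)
  exact φ.stronglyMeasurable

instance [∀ k, NeZero (m k)] : IsProbabilityMeasure (haar m) := by
  unfold haar
  infer_instance

theorem _root_.DependsOn.exists_norm_le [∀ k, NeZero (m k)] {E : Type*} [NormedAddCommGroup E]
    {n : ℕ} {f : G m → E} (hf : DependsOn f (Set.Iio n)) : ∃ C : ℝ, ∀ x, ‖f x‖ ≤ C := by
  refine ⟨∑ y ∈ reps m n, ‖f y‖, fun x => ?_⟩
  rw [hf.eq_trunc x]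
  exact Finset.single_le_sum (f := fun y => ‖f y‖) (fun _ _ => norm_nonneg _)
    (trunc_mem_reps n x)

theorem _root_.DependsOn.integrable [∀ k, NeZero (m k)] {E : Type*} [NormedAddCommGroup E]
    {n : ℕ} {f : G m → E} (hf : DependsOn f (Set.Iio n)) : Integrable f (haar m) := by
  obtain ⟨C, hC⟩ := hf.exists_norm_le
  exact Integrable.of_bound
    (hf.stronglyMeasurable.mono ((filtration m).le n)).aestronglyMeasurable C (ae_of_all _ hC)

/-- The measure of a cylinder fixing the coordinates in a finite set. -/
theorem haar_cylinder [∀ k, NeZero (m k)] (S : Finset ℕ) (z : G m) :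
    (haar m).real {x | ∀ i ∈ S, x i = z i} = ∏ i ∈ S, (m i : ℝ)⁻¹ := by
  have h : {x : G m | ∀ i ∈ S, x i = z i} = Set.pi S fun i => {z i} := by
    ext x; simp
  rw [h, Measure.real, haar, Measure.infinitePi_pi _ fun i _ => measurableSet_singleton _]
  rw [ENNReal.toReal_prod]
  refine Finset.prod_congr rfl fun i _ => ?_
  rw [uniformOn_univ]
  simp [ZMod.card]

theorem haar_interval [∀ k, NeZero (m k)] (n : ℕ) (x : G m) :
    (haar m).real (interval m n x) = (M m n : ℝ)⁻¹ := by
  have h := haar_cylinder (Finset.range n) x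
  simp only [Finset.mem_range] at h
  rw [interval, h, M_eq_prod, Finset.prod_inv_distrib]
  push_cast
  rfl

theorem measurePreserving_add_right [∀ k, NeZero (m k)] (z : G m) :
    MeasurePreserving (fun x : G m => x + z) (haar m) (haar m) := by
  refine ⟨measurable_pi_lambda _ fun i =>
    (measurable_of_countable fun a : ZMod (m i) => a + z i).comp (measurable_pi_apply i), ?_⟩
  have h : ∀ i, (uniformOn (Set.univ : Set (ZMod (m i)))).map (fun a => a + z i) =
      uniformOn (Set.univ : Set (ZMod (m i))) := by
    intro i
    refine Measure.ext_of_singleton fun a => ?_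
    rw [Measure.map_apply (measurable_of_countable _) (measurableSet_singleton a),
      uniformOn_univ, uniformOn_univ]
    have : (fun a => a + z i) ⁻¹' {a} = {a - z i} := by
      ext b; exact eq_sub_iff_add_eq.symm
    rw [this, Measure.count_singleton, Measure.count_singleton]
  have h2 := Measure.infinitePi_map_pi
    (fun i => uniformOn (Set.univ : Set (ZMod (m i)))) (f := fun i a => a + z i)
    (fun i => measurable_of_countable _)
  unfold haar
  simp only [h] at h2
  exact h2

end Basic

/-! ### Dirichlet and Fejér kernels and their pointwise majorants. -/

section Kernels

variable {m : ℕ → ℕ}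

theorem rademacher_eq_stdAddChar [∀ k, NeZero (m k)] (k : ℕ) (x : G m) :
    rademacher m k x = ZMod.stdAddChar (x k) := by
  rw [ZMod.stdAddChar_apply, ZMod.toCircle_apply, rademacher]

theorem norm_rademacher [∀ k, NeZero (m k)] (k : ℕ) (x : G m) : ‖rademacher m k x‖ = 1 := by
  rw [rademacher_eq_stdAddChar, ZMod.stdAddChar_apply, Circle.norm_coe]

theorem rademacher_sub [∀ k, NeZero (m k)] (k : ℕ) (x y : G m) :
    rademacher m k (x - y) = rademacher m k x * (starRingEnd ℂ) (rademacher m k y) := by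
  have h : (starRingEnd ℂ) (rademacher m k y) = (rademacher m k y)⁻¹ := by
    rw [rademacher_eq_stdAddChar, ZMod.stdAddChar_apply, ← Circle.coe_inv_eq_conj, Circle.coe_inv]
  rw [h]
  simp only [rademacher_eq_stdAddChar, Pi.sub_apply]
  rw [AddChar.map_sub_eq_div, div_eq_mul_inv]

theorem sum_rademacher_pow [∀ k, NeZero (m k)] (k : ℕ) (x : G m) :
    ∑ i ∈ Finset.range (m k), rademacher m k x ^ i = if x k = 0 then (m k : ℂ) else 0 := by
  rw [rademacher_eq_stdAddChar]
  split_ifs with h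
  · simp [h]
  · have h1 : ZMod.stdAddChar (x k) ≠ 1 := fun h1 => h <|
      ZMod.injective_stdAddChar (h1.trans (AddChar.map_zero_eq_one _).symm)
    rw [geom_sum_eq h1, ← AddChar.map_nsmul_eq_pow]
    simp

theorem digit_eq_zero {n k : ℕ} (h : n < M m k) : digit m n k = 0 := by
  rw [digit, Nat.div_eq_of_lt h, Nat.zero_mod]

theorem psi_eq_prod (hm : ∀ k, 2 ≤ m k) {n K : ℕ} (h : n < M m K) (x : G m) :
    psi m n x = ∏ k ∈ Finset.range K, rademacher m k x ^ digit m n k := by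
  have key : ∀ a c, a ≤ c → n < M m a →
      ∏ k ∈ Finset.range a, rademacher m k x ^ digit m n k =
        ∏ k ∈ Finset.range c, rademacher m k x ^ digit m n k := by
    intro a c hac ha
    refine Finset.prod_subset (Finset.range_mono hac) fun k _ hk => ?_
    rw [digit_eq_zero (ha.trans_le (M_mono hm (by simpa using hk))), pow_zero]
  rcases le_total n K with h' | h'
  · exact key n K h' (lt_M hm n)
  · exact (key K n h' h).symm

/-- The leading digit `a` splits off: the digits below `A` are those of `j`, because `M_{k+1}`
divides `M_A` for `k < A`. All kernel recursions below rest on this factorization. -/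
theorem psi_mul_M_add (hm : ∀ k, 2 ≤ m k) {A a j : ℕ} (ha : a < m A) (hj : j < M m A) (x : G m) :
    psi m (a * M m A + j) x = rademacher m A x ^ a * psi m j x := by
  have hn : a * M m A + j < M m (A + 1) := by
    calc a * M m A + j < a * M m A + M m A := by omega
      _ = (a + 1) * M m A := by ring
      _ ≤ M m (A + 1) := Nat.mul_le_mul_right _ ha
  rw [psi_eq_prod hm hn, psi_eq_prod hm hj, Finset.prod_range_succ, mul_comm]
  congr 1
  · congr 1
    have hpos : 0 < M m A := by omega
    rw [digit, add_comm, Nat.add_mul_div_right _ _ hpos, Nat.div_eq_of_lt hj, zero_add,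
      Nat.mod_eq_of_lt ha]
  · refine Finset.prod_congr rfl fun k hk => ?_
    congr 1
    have hk' : k < A := by simpa using hk
    have hdvd : M m (k + 1) ∣ M m A := by
      rw [M_eq_prod, M_eq_prod]
      exact Finset.prod_dvd_prod_of_subset _ _ _ (Finset.range_mono hk')
    obtain ⟨e, he⟩ := hdvd
    have hpos : 0 < M m k := by have := lt_M hm k; omega
    rw [digit, digit, he, M_succ, show a * (m k * M m k * e) + j = j + (a * m k * e) * M m k by ring,
      Nat.add_mul_div_right _ _ hpos, show a * m k * e = m k * (a * e) by ring,
      Nat.add_mul_mod_self_left]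

theorem norm_psi [∀ k, NeZero (m k)] (n : ℕ) (x : G m) : ‖psi m n x‖ = 1 := by
  simp [psi, norm_rademacher]

theorem psi_sub [∀ k, NeZero (m k)] (n : ℕ) (x y : G m) :
    psi m n (x - y) = psi m n x * (starRingEnd ℂ) (psi m n y) := by
  simp only [psi, rademacher_sub, mul_pow, Finset.prod_mul_distrib, map_prod, map_pow]

theorem dependsOn_psi (hm : ∀ k, 2 ≤ m k) {n A : ℕ} (h : n < M m A) :
    DependsOn (psi m n) (Set.Iio A) := by
  intro x y hxy
  rw [psi_eq_prod hm h, psi_eq_prod hm h]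
  refine Finset.prod_congr rfl fun k hk => ?_
  rw [rademacher, rademacher, hxy k (by simpa using hk)]

/-- The Dirichlet kernel. -/
def dirichlet (m : ℕ → ℕ) (n : ℕ) (x : G m) : ℂ := ∑ i ∈ Finset.range n, psi m i x

/-- The sum of the first `n` Dirichlet kernels, that is, `n` times the Fejér kernel. -/
def fejer (m : ℕ → ℕ) (n : ℕ) (x : G m) : ℂ := ∑ j ∈ Finset.range n, dirichlet m j x

theorem dependsOn_dirichlet (hm : ∀ k, 2 ≤ m k) {n A : ℕ} (h : n ≤ M m A) :
    DependsOn (dirichlet m n) (Set.Iio A) := fun _ _ hxy =>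
  Finset.sum_congr rfl fun i hi =>
    dependsOn_psi hm ((by simpa using hi : i < n).trans_le h) hxy

theorem dependsOn_fejer (hm : ∀ k, 2 ≤ m k) {n A : ℕ} (h : n ≤ M m A) :
    DependsOn (fejer m n) (Set.Iio A) := fun _ _ hxy =>
  Finset.sum_congr rfl fun i hi =>
    dependsOn_dirichlet hm ((by simpa using hi : i < n).le.trans h) hxy

theorem dirichlet_mul_M_add (hm : ∀ k, 2 ≤ m k) {A a j : ℕ} (ha : a < m A) (hj : j ≤ M m A)
    (x : G m) : dirichlet m (a * M m A + j) x =
      dirichlet m (a * M m A) x + rademacher m A x ^ a * dirichlet m j x := by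
  rw [dirichlet, Finset.sum_range_add, dirichlet, dirichlet, Finset.mul_sum]
  congr 1
  exact Finset.sum_congr rfl fun i hi =>
    psi_mul_M_add hm ha ((by simpa using hi : i < j).trans_le hj) x

theorem dirichlet_mul_M (hm : ∀ k, 2 ≤ m k) {A a : ℕ} (ha : a ≤ m A) (x : G m) :
    dirichlet m (a * M m A) x =
      (∑ i ∈ Finset.range a, rademacher m A x ^ i) * dirichlet m (M m A) x := by
  induction a with
  | zero => simp [dirichlet]
  | succ a ih =>
    rw [Nat.add_mul, one_mul, dirichlet_mul_M_add hm ha le_rfl, ih (by omega),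
      Finset.sum_range_succ, add_mul]

/-- Paley's lemma. Each step multiplies by a complete sum of powers of a root of unity, which is
`m_A` if `x_A = 0` and vanishes otherwise. -/
theorem dirichlet_M [∀ k, NeZero (m k)] (hm : ∀ k, 2 ≤ m k) (A : ℕ) (x : G m) :
    dirichlet m (M m A) x = (interval m A 0).indicator (fun _ => (M m A : ℂ)) x := by
  induction A with
  | zero => simp [dirichlet, M, interval, psi]
  | succ A ih =>
    rw [M_succ, dirichlet_mul_M hm le_rfl, ih, sum_rademacher_pow]
    have h : x ∈ interval m (A + 1) 0 ↔ x ∈ interval m A 0 ∧ x A = 0 := by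
      simp only [mem_interval, Nat.lt_succ_iff_lt_or_eq]
      exact ⟨fun h => ⟨fun i hi => h i (Or.inl hi), h A (Or.inr rfl)⟩, fun h i hi =>
        hi.elim (h.1 i) fun h' => h' ▸ h.2⟩
    by_cases h1 : x ∈ interval m A 0 <;> by_cases h2 : x A = 0 <;>
      simp [Set.indicator, h, h1, h2]

theorem norm_dirichlet_M [∀ k, NeZero (m k)] (hm : ∀ k, 2 ≤ m k) (A : ℕ) (x : G m) :
    ‖dirichlet m (M m A) x‖ = (interval m A 0).indicator (fun _ => (M m A : ℝ)) x := by
  rw [dirichlet_M hm]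
  by_cases h1 : x ∈ interval m A 0 <;> simp [h1]

theorem norm_sum_rademacher_pow_le [∀ k, NeZero (m k)] (k a : ℕ) (x : G m) :
    ‖∑ i ∈ Finset.range a, rademacher m k x ^ i‖ ≤ a := by
  refine (norm_sum_le _ _).trans ?_
  simp [norm_rademacher]

theorem fejer_mul_M_add (hm : ∀ k, 2 ≤ m k) {A a j : ℕ} (ha : a < m A) (hj : j ≤ M m A)
    (x : G m) : fejer m (a * M m A + j) x =
      fejer m (a * M m A) x + j * dirichlet m (a * M m A) x +
        rademacher m A x ^ a * fejer m j x := by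
  rw [fejer, Finset.sum_range_add, add_assoc]
  congr 1
  rw [fejer, Finset.mul_sum]
  have : ∀ i ∈ Finset.range j, dirichlet m (a * M m A + i) x =
      dirichlet m (a * M m A) x + rademacher m A x ^ a * dirichlet m i x := fun i hi =>
    dirichlet_mul_M_add hm ha ((by simpa using hi : i < j).le.trans hj) x
  rw [Finset.sum_congr rfl this, Finset.sum_add_distrib]
  simp

theorem fejer_mul_M (hm : ∀ k, 2 ≤ m k) {A a : ℕ} (ha : a ≤ m A) (x : G m) :
    fejer m (a * M m A) x = M m A * ∑ i ∈ Finset.range a, dirichlet m (i * M m A) x +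
      (∑ i ∈ Finset.range a, rademacher m A x ^ i) * fejer m (M m A) x := by
  induction a with
  | zero => simp [fejer]
  | succ a ih =>
    rw [Nat.add_mul, one_mul, fejer_mul_M_add hm ha le_rfl, ih (by omega),
      Finset.sum_range_succ, Finset.sum_range_succ]
    ring

/-- The points whose first `s` coordinates vanish, except possibly the one of index `k`. -/
def cross (m : ℕ → ℕ) (k s : ℕ) : Set (G m) := {z | ∀ i < s, i ≠ k → z i = 0}

/-- The majorant of the Fejér kernels. -/
def majorant (m : ℕ → ℕ) (N : ℕ) (z : G m) : ℝ :=
  ∑ s ∈ Finset.range (N + 1), ∑ k ∈ Finset.range (s + 1),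
    (cross m k s).indicator (fun _ => (M m k * M m s : ℝ)) z

theorem cross_self (s : ℕ) : cross m s s = interval m s 0 := by
  ext z
  exact ⟨fun h i hi => h i hi hi.ne, fun h i hi _ => h i hi⟩

theorem cross_succ_self (s : ℕ) : cross m s (s + 1) = interval m s 0 := by
  ext z
  exact ⟨fun h i hi => h i (by omega) hi.ne, fun h i hi his => h i (by omega)⟩

theorem mem_cross_succ {k s : ℕ} (hk : k < s) {z : G m} :
    z ∈ cross m k (s + 1) ↔ z ∈ cross m k s ∧ z s = 0 := by
  refine ⟨fun h => ⟨fun i hi => h i (by omega), h s (by omega) (by omega)⟩, fun h i hi hik => ?_⟩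
  rcases Nat.lt_succ_iff_lt_or_eq.1 hi with h' | rfl
  exacts [h.1 i h' hik, h.2]

theorem cross_term_nonneg (k s : ℕ) (z : G m) :
    0 ≤ (cross m k s).indicator (fun _ => (M m k * M m s : ℝ)) z :=
  Set.indicator_nonneg (fun _ _ => by positivity) z

theorem norm_dirichlet_mul_M_le [∀ k, NeZero (m k)] (hm : ∀ k, 2 ≤ m k) {b : ℕ}
    (hb : ∀ k, m k ≤ b) {A a : ℕ} (ha : a ≤ m A) (x : G m) :
    ‖dirichlet m (a * M m A) x‖ ≤ b * (interval m A 0).indicator (fun _ => (M m A : ℝ)) x := by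
  rw [dirichlet_mul_M hm ha, norm_mul, norm_dirichlet_M hm]
  refine mul_le_mul_of_nonneg_right ((norm_sum_rademacher_pow_le A a x).trans ?_)
    (Set.indicator_nonneg (fun _ _ => by positivity) _)
  exact_mod_cast ha.trans (hb A)

theorem norm_sum_dirichlet_mul_M_le [∀ k, NeZero (m k)] (hm : ∀ k, 2 ≤ m k) {b : ℕ}
    (hb : ∀ k, m k ≤ b) {A a : ℕ} (ha : a ≤ m A) (x : G m) :
    ‖(M m A : ℂ) * ∑ i ∈ Finset.range a, dirichlet m (i * M m A) x‖ ≤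
      b ^ 2 * (cross m A A).indicator (fun _ => (M m A * M m A : ℝ)) x := by
  rw [norm_mul, Complex.norm_natCast, cross_self]
  have h : ‖∑ i ∈ Finset.range a, dirichlet m (i * M m A) x‖ ≤
      b * (b * (interval m A 0).indicator (fun _ => (M m A : ℝ)) x) := by
    refine (norm_sum_le_of_le _ fun i hi =>
      norm_dirichlet_mul_M_le hm hb ((by simpa using hi : i < a).le.trans ha) x).trans ?_
    rw [Finset.sum_const, Finset.card_range, nsmul_eq_mul]
    refine mul_le_mul_of_nonneg_right (by exact_mod_cast ha.trans (hb A)) ?_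
    exact mul_nonneg (by positivity) (Set.indicator_nonneg (fun _ _ => by positivity) _)
  refine (mul_le_mul_of_nonneg_left h (by positivity)).trans (le_of_eq ?_)
  by_cases h1 : x ∈ interval m A 0
  · simp only [Set.indicator_of_mem h1]; ring
  · simp [h1]

/-- The recursion for `fejer m (M m (s + 1))` has a block of Dirichlet kernels and a multiple of the
previous kernel that survives only where `x_s = 0`. The constant does not grow in the induction,
because the contributions land in different terms: the block goes to `k = s`, old terms with `k < s`
keep their index, and the old diagonal term becomes the new diagonal one. -/
theorem norm_fejer_M_le [∀ k, NeZero (m k)] (hm : ∀ k, 2 ≤ m k) {b : ℕ}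
    (hb : ∀ k, m k ≤ b) (s : ℕ) (x : G m) :
    ‖fejer m (M m s) x‖ ≤ b ^ 2 * ∑ k ∈ Finset.range (s + 1),
      (cross m k s).indicator (fun _ => (M m k * M m s : ℝ)) x := by
  have hb1 : (1 : ℝ) ≤ b := by exact_mod_cast (by have := hm 0; have := hb 0; omega : 1 ≤ b)
  induction s with
  | zero =>
    have h : fejer m (M m 0) x = 0 := by simp [M, fejer, dirichlet]
    rw [h, norm_zero]
    exact mul_nonneg (by positivity) (Finset.sum_nonneg fun _ _ => cross_term_nonneg _ _ _)
  | succ s ih =>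
    have hF : fejer m (M m (s + 1)) x =
        M m s * ∑ i ∈ Finset.range (m s), dirichlet m (i * M m s) x +
          (if x s = 0 then (m s : ℂ) else 0) * fejer m (M m s) x := by
      rw [M_succ, fejer_mul_M hm le_rfl, sum_rademacher_pow]
    rw [hF]
    refine (norm_add_le _ _).trans ?_
    have h1 := norm_sum_dirichlet_mul_M_le hm hb (le_refl (m s)) x
    have hMs : (M m (s + 1) : ℝ) = m s * M m s := by rw [M_succ]; push_cast; ring
    have hms : (1 : ℝ) ≤ m s := by exact_mod_cast (by have := hm s; omega : 1 ≤ m s)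
    have hM0 : (0 : ℝ) ≤ M m s := by positivity
    -- Leaving coordinate `s` free, `cross m s (s + 1)` is the same set as `cross m s s`, so only
    -- the weight changes.
    have h2 : (cross m s s).indicator (fun _ => (M m s * M m s : ℝ)) x ≤
        (cross m s (s + 1)).indicator (fun _ => (M m s * M m (s + 1) : ℝ)) x := by
      rw [cross_self, cross_succ_self]
      refine Set.indicator_le_indicator ?_
      rw [hMs]
      nlinarith [mul_nonneg hM0 hM0]
    have h3 : ‖(if x s = 0 then (m s : ℂ) else 0) * fejer m (M m s) x‖ ≤
        b ^ 2 * ((∑ k ∈ Finset.range s,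
          (cross m k (s + 1)).indicator (fun _ => (M m k * M m (s + 1) : ℝ)) x) +
          (cross m (s + 1) (s + 1)).indicator
            (fun _ => (M m (s + 1) * M m (s + 1) : ℝ)) x) := by
      split_ifs with h0
      · rw [norm_mul, Complex.norm_natCast]
        refine (mul_le_mul_of_nonneg_left ih (by positivity)).trans ?_
        rw [mul_left_comm]
        refine mul_le_mul_of_nonneg_left ?_ (by positivity)
        rw [Finset.sum_range_succ, mul_add, Finset.mul_sum]
        refine add_le_add (Finset.sum_le_sum fun k hk => ?_) ?_
        · have hk' : k < s := by simpa using hk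
          by_cases hx : x ∈ cross m k s
          · rw [Set.indicator_of_mem hx, Set.indicator_of_mem ((mem_cross_succ hk').2 ⟨hx, h0⟩),
              hMs]
            exact le_of_eq (by ring)
          · rw [Set.indicator_of_notMem hx, mul_zero]
            exact cross_term_nonneg _ _ _
        · by_cases hx : x ∈ cross m s s
          · have hx' : x ∈ cross m (s + 1) (s + 1) := by
              intro i hi _
              rcases Nat.lt_succ_iff_lt_or_eq.1 hi with h' | rfl
              exacts [hx i h' h'.ne, h0]
            rw [Set.indicator_of_mem hx, Set.indicator_of_mem hx', hMs]
            nlinarith [mul_nonneg hM0 hM0, mul_nonneg (mul_nonneg hM0 hM0)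
              (mul_nonneg (by linarith : (0 : ℝ) ≤ m s) (by linarith : (0 : ℝ) ≤ m s - 1))]
          · rw [Set.indicator_of_notMem hx, mul_zero]
            exact cross_term_nonneg _ _ _
      · rw [zero_mul, norm_zero]
        exact mul_nonneg (by positivity) (add_nonneg
          (Finset.sum_nonneg fun _ _ => cross_term_nonneg _ _ _) (cross_term_nonneg _ _ _))
    rw [Finset.sum_range_succ, Finset.sum_range_succ]
    have h4 := mul_le_mul_of_nonneg_left h2 (by positivity : (0 : ℝ) ≤ (b : ℝ) ^ 2)
    linarith

/-- Induction on the number of digits: removing the leading digit `a` of `n` leaves a unimodular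
multiple of `fejer` at the remainder and three terms, each at most `b ^ 4` times the row `s = A` of
the majorant. -/
theorem norm_fejer_le [∀ k, NeZero (m k)] (hm : ∀ k, 2 ≤ m k) {b : ℕ}
    (hb : ∀ k, m k ≤ b) {A n : ℕ} (hn : n < M m A) (x : G m) :
    ‖fejer m n x‖ ≤ 4 * b ^ 4 * ∑ s ∈ Finset.range A, ∑ k ∈ Finset.range (s + 1),
      (cross m k s).indicator (fun _ => (M m k * M m s : ℝ)) x := by
  have hb1 : (1 : ℝ) ≤ b := by exact_mod_cast (by have := hm 0; have := hb 0; omega : 1 ≤ b)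
  induction A generalizing n with
  | zero =>
    have : n = 0 := by simpa [M] using hn
    simp [this, fejer]
  | succ A ih =>
    have hpos : 0 < M m A := M_pos A
    have hdiv : n / M m A < m A := (Nat.div_lt_iff_lt_mul hpos).2 hn
    have hmod : n % M m A < M m A := Nat.mod_lt _ hpos
    have hdec : n / M m A * M m A + n % M m A = n := Nat.div_add_mod' n _
    rw [← hdec, fejer_mul_M_add hm hdiv hmod.le, fejer_mul_M hm hdiv.le, Finset.sum_range_succ,
      mul_add]
    set a := n / M m A
    set j := n % M m A
    set R := ∑ k ∈ Finset.range (A + 1),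
      (cross m k A).indicator (fun _ => (M m k * M m A : ℝ)) x
    have hR : (cross m A A).indicator (fun _ => (M m A * M m A : ℝ)) x ≤ R :=
      Finset.single_le_sum
        (f := fun k => (cross m k A).indicator (fun _ => (M m k * M m A : ℝ)) x)
        (fun k _ => cross_term_nonneg _ _ _) (Finset.self_mem_range_succ A)
    have hR0 : 0 ≤ R := Finset.sum_nonneg fun _ _ => cross_term_nonneg _ _ _
    have h1 := norm_sum_dirichlet_mul_M_le hm hb hdiv.le x
    have h2 : ‖(∑ i ∈ Finset.range a, rademacher m A x ^ i) * fejer m (M m A) x‖ ≤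
        b * (b ^ 2 * R) := by
      rw [norm_mul]
      exact mul_le_mul ((norm_sum_rademacher_pow_le A a x).trans
        (by exact_mod_cast hdiv.le.trans (hb A))) (norm_fejer_M_le hm hb A x) (norm_nonneg _)
        (by positivity)
    have h3 : ‖(j : ℂ) * dirichlet m (a * M m A) x‖ ≤
        b * (cross m A A).indicator (fun _ => (M m A * M m A : ℝ)) x := by
      rw [norm_mul, Complex.norm_natCast, cross_self]
      refine (mul_le_mul (by exact_mod_cast hmod.le : (j : ℝ) ≤ M m A)
        (norm_dirichlet_mul_M_le hm hb hdiv.le x) (norm_nonneg _) (by positivity)).trans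
        (le_of_eq ?_)
      by_cases hx : x ∈ interval m A 0
      · simp only [Set.indicator_of_mem hx]; ring
      · simp [hx]
    have h4 : ‖rademacher m A x ^ a * fejer m j x‖ = ‖fejer m j x‖ := by
      simp [norm_rademacher]
    refine (norm_add_le _ _).trans ?_
    rw [h4, add_comm]
    refine add_le_add (ih hmod) ?_
    refine (norm_add_le _ _).trans ((add_le_add_left (norm_add_le _ _) _).trans ?_)
    have e1 : (b : ℝ) ^ 2 * (cross m A A).indicator (fun _ => (M m A * M m A : ℝ)) x ≤
        b ^ 4 * R := mul_le_mul (pow_le_pow_right₀ hb1 (by norm_num)) hR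
          (cross_term_nonneg _ _ _) (by positivity)
    have e2 : (b : ℝ) * (cross m A A).indicator (fun _ => (M m A * M m A : ℝ)) x ≤
        b ^ 4 * R := mul_le_mul (by simpa using pow_le_pow_right₀ hb1 (by norm_num : 1 ≤ 4)) hR
          (cross_term_nonneg _ _ _) (by positivity)
    have e3 : (b : ℝ) * (b ^ 2 * R) ≤ b ^ 4 * R := by
      rw [← mul_assoc]
      refine mul_le_mul_of_nonneg_right ?_ hR0
      calc (b : ℝ) * (b : ℝ) ^ 2 = (b : ℝ) ^ 3 := by ring
        _ ≤ (b : ℝ) ^ 4 := pow_le_pow_right₀ hb1 (by norm_num)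
    have e4 : 0 ≤ (b : ℝ) ^ 4 * R := by positivity
    linarith

end Kernels

/-! ### Truncated sums along geometrically growing sequences. -/

section Sums

theorem min_add_le_min_add_min {u v L : ℝ} (hu : 0 ≤ u) (hv : 0 ≤ v) (hL : 0 ≤ L) :
    min (u + v) L ≤ min u L + min v L := by
  rcases le_total u L with h1 | h1 <;> rcases le_total v L with h2 | h2 <;>
    simp only [min_eq_left, min_eq_right, h1, h2]
  · exact min_le_left _ _
  · exact (min_le_right _ _).trans (by linarith)
  · exact (min_le_right _ _).trans (by linarith)
  · exact (min_le_right _ _).trans (by linarith)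

theorem min_sum_le_sum_min {ι : Type*} (s : Finset ι) (u : ι → ℝ) (hu : ∀ i ∈ s, 0 ≤ u i)
    {L : ℝ} (hL : 0 ≤ L) : min (∑ i ∈ s, u i) L ≤ ∑ i ∈ s, min (u i) L := by
  classical
  induction s using Finset.induction_on with
  | empty => simp [hL]
  | insert i s hi ih =>
    rw [Finset.sum_insert hi, Finset.sum_insert hi]
    have hs : ∀ j ∈ s, 0 ≤ u j := fun j hj => hu j (Finset.mem_insert_of_mem hj)
    refine (min_add_le_min_add_min (hu i (Finset.mem_insert_self i s))
      (Finset.sum_nonneg hs) hL).trans ?_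
    linarith [ih hs]

/-- If a positive sequence at least doubles at each step, the sum of `min (t l) (t l)⁻¹` is
bounded by an absolute constant. -/
theorem sum_min_inv_le {t : ℕ → ℝ} (ht : ∀ l, 0 < t l) (h2 : ∀ l, 2 * t l ≤ t (l + 1)) (L : ℕ) :
    ∑ l ∈ Finset.range L, min (t l) (t l)⁻¹ ≤ 3 := by
  -- A potential bounded by `3` that grows by at least `min u u⁻¹` whenever its argument at least
  -- doubles, so the sum telescopes.
  let φ : ℝ → ℝ := fun u => if u ≤ 1 then u else 3 - 2 / u
  have key : ∑ l ∈ Finset.range L, min (t l) (t l)⁻¹ ≤ φ (t L) := by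
    induction L with
    | zero =>
      have h0 := ht 0
      simp only [Finset.range_zero, Finset.sum_empty, φ]
      split_ifs with h
      · exact h0.le
      · have : 2 / t 0 ≤ 2 := (div_le_iff₀ h0).2 (by linarith)
        linarith
    | succ L ih =>
      rw [Finset.sum_range_succ]
      have h0 := ht L
      have h1 := ht (L + 1)
      have h3 := h2 L
      simp only [φ] at ih ⊢
      split_ifs at ih with hL
      · have h4 : min (t L) (t L)⁻¹ ≤ t L := min_le_left _ _
        split_ifs with hL1
        · linarith
        · have h5 : 2 / t (L + 1) ≤ 3 - 2 * t L := by
            rw [div_le_iff₀ h1]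
            rcases le_total (t L) (1 / 2) with h6 | h6
            · nlinarith
            · nlinarith [mul_nonneg (by linarith : (0 : ℝ) ≤ 3 - 2 * t L)
                (by linarith : 0 ≤ t (L + 1) - 2 * t L)]
          linarith
      · have h4 : min (t L) (t L)⁻¹ ≤ (t L)⁻¹ := min_le_right _ _
        have hL1 : ¬ t (L + 1) ≤ 1 := by linarith
        rw [if_neg hL1]
        have h5 : 2 / t (L + 1) ≤ (t L)⁻¹ := by
          rw [div_le_iff₀ h1, ← div_eq_inv_mul, le_div_iff₀ h0]
          exact h3
        have h6 : 2 / t L = 2 * (t L)⁻¹ := div_eq_mul_inv _ _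
        linarith
  refine key.trans ?_
  simp only [φ]
  split_ifs with h
  · linarith
  · have : 0 ≤ 2 / t L := div_nonneg (by norm_num) (ht L).le
    linarith

/-- Scaling `t` by `√a / √β` balances the two branches and leaves the factor `√(a * β)`. -/
theorem sum_min_mul_div_le {t : ℕ → ℝ} (ht : ∀ l, 0 < t l) (h2 : ∀ l, 2 * t l ≤ t (l + 1))
    {a β : ℝ} (ha : 0 < a) (hβ : 0 < β) (L : ℕ) :
    ∑ l ∈ Finset.range L, min (a * t l) (β / t l) ≤ 3 * √(a * β) := by
  have hsa := Real.sqrt_pos.2 ha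
  have hsβ := Real.sqrt_pos.2 hβ
  have haa := Real.mul_self_sqrt ha.le
  have hββ := Real.mul_self_sqrt hβ.le
  have h := sum_min_inv_le (t := fun l => √a / √β * t l)
    (fun l => mul_pos (div_pos hsa hsβ) (ht l))
    (fun l => by
      have := mul_le_mul_of_nonneg_left (h2 l) (div_pos hsa hsβ).le
      linarith) L
  calc ∑ l ∈ Finset.range L, min (a * t l) (β / t l)
      = ∑ l ∈ Finset.range L, √(a * β) * min (√a / √β * t l) (√a / √β * t l)⁻¹ := by
        refine Finset.sum_congr rfl fun l _ => ?_
        have := ht l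
        rw [mul_min_of_nonneg _ _ (Real.sqrt_nonneg _), Real.sqrt_mul ha.le]
        congr 1
        · field_simp
          rw [Real.sq_sqrt ha.le]
        · field_simp
          rw [Real.sq_sqrt hβ.le]
    _ = √(a * β) * ∑ l ∈ Finset.range L, min (√a / √β * t l) (√a / √β * t l)⁻¹ := by
        rw [Finset.mul_sum]
    _ ≤ √(a * β) * 3 := mul_le_mul_of_nonneg_left h (Real.sqrt_nonneg _)
    _ = 3 * √(a * β) := mul_comm _ _

theorem sum_sqrt_half_pow_le (L : ℕ) : ∑ i ∈ Finset.range L, √(1 / 2 : ℝ) ^ i ≤ 4 := by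
  have h0 : 0 ≤ √(1 / 2 : ℝ) := Real.sqrt_nonneg _
  have h1 : √(1 / 2 : ℝ) ≤ 3 / 4 := by
    rw [Real.sqrt_le_left (by norm_num)]
    norm_num
  calc ∑ i ∈ Finset.range L, √(1 / 2 : ℝ) ^ i ≤ ∑ i ∈ Finset.range L, (3 / 4 : ℝ) ^ i :=
        Finset.sum_le_sum fun i _ => pow_le_pow_left₀ h0 h1 i
    _ ≤ 4 := by
        have : (0 : ℝ) ≤ (3 / 4 : ℝ) ^ L := by positivity
        rw [geom_sum_eq (by norm_num), div_le_iff_of_neg (by norm_num)]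
        linarith

/-- For a fixed gap `i = s - k` one has `t k ≤ 2^{-i} t s`, so the sum over `s` is at most `3 √(c
2^{-i} β)`. The resulting series in `i` is geometric with sum at most `4`. -/
theorem sum_sum_min_le {t : ℕ → ℝ} (ht : ∀ l, 0 < t l) (h2 : ∀ l, 2 * t l ≤ t (l + 1))
    {c β : ℝ} (hc : 0 < c) (hβ : 0 < β) (L : ℕ) :
    ∑ s ∈ Finset.range L, ∑ k ∈ Finset.range (s + 1), min (c * (t k * t s)) β / t s ≤
      12 * √(c * β) := by
  have hpow : ∀ k i, 2 ^ i * t k ≤ t (k + i) := by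
    intro k i
    induction i with
    | zero => simp
    | succ i ih =>
      calc 2 ^ (i + 1) * t k = 2 * (2 ^ i * t k) := by ring
        _ ≤ 2 * t (k + i) := by linarith
        _ ≤ t (k + (i + 1)) := h2 _
  have h1 : ∀ s ∈ Finset.range L,
      ∑ k ∈ Finset.range (s + 1), min (c * (t k * t s)) β / t s ≤
        ∑ i ∈ Finset.range L, min (c * (1 / 2) ^ i * t s) (β / t s) := by
    intro s hs
    -- After reflection the index `i` is the gap `s - k`.
    rw [← Finset.sum_range_reflect]
    refine (Finset.sum_le_sum (g := fun i => min (c * (1 / 2) ^ i * t s) (β / t s))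
      fun i hi => ?_).trans (Finset.sum_le_sum_of_subset_of_nonneg
        (Finset.range_mono (by simpa using hs)) fun i _ _ => ?_)
    · have hi' : i ≤ s := by simpa [Nat.lt_succ_iff] using hi
      have hts := ht s
      have hk : t (s + 1 - 1 - i) ≤ (1 / 2) ^ i * t s := by
        have := hpow (s + 1 - 1 - i) i
        rw [show s + 1 - 1 - i + i = s by omega] at this
        calc t (s + 1 - 1 - i) = (1 / 2) ^ i * (2 ^ i * t (s + 1 - 1 - i)) := by
              rw [← mul_assoc, ← mul_pow]; norm_num
          _ ≤ _ := mul_le_mul_of_nonneg_left this (by positivity)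
      rw [← min_div_div_right hts.le]
      refine min_le_min ?_ le_rfl
      rw [div_le_iff₀ hts]
      calc c * (t (s + 1 - 1 - i) * t s) ≤ c * ((1 / 2) ^ i * t s * t s) := by gcongr
        _ = _ := by ring
    · have := ht s
      exact le_min (by positivity) (by positivity)
  calc _ ≤ ∑ s ∈ Finset.range L, ∑ i ∈ Finset.range L,
        min (c * (1 / 2) ^ i * t s) (β / t s) := Finset.sum_le_sum h1
    _ = ∑ i ∈ Finset.range L, ∑ s ∈ Finset.range L,
        min (c * (1 / 2) ^ i * t s) (β / t s) := Finset.sum_comm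
    _ ≤ ∑ i ∈ Finset.range L, 3 * √(c * (1 / 2) ^ i * β) :=
        Finset.sum_le_sum fun i _ => sum_min_mul_div_le ht h2 (by positivity) hβ L
    _ = 3 * √(c * β) * ∑ i ∈ Finset.range L, √(1 / 2 : ℝ) ^ i := by
        rw [Finset.mul_sum]
        refine Finset.sum_congr rfl fun i _ => ?_
        have hsq : √((1 / 2 : ℝ) ^ i) = √(1 / 2) ^ i := by
          rw [Real.sqrt_eq_iff_mul_self_eq (by positivity) (by positivity), ← mul_pow,
            Real.mul_self_sqrt (by norm_num)]
        rw [show c * (1 / 2) ^ i * β = c * β * (1 / 2) ^ i by ring,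
          Real.sqrt_mul (by positivity), hsq]
        ring
    _ ≤ 3 * √(c * β) * 4 :=
        mul_le_mul_of_nonneg_left (sum_sqrt_half_pow_le L) (by positivity)
    _ = 12 * √(c * β) := by ring

end Sums

/-! ### Fejér means of a single atom and superposition of atoms. -/

section Atoms

variable {m : ℕ → ℕ}

theorem majorant_nonneg (N : ℕ) (z : G m) : 0 ≤ majorant m N z :=
  Finset.sum_nonneg fun _ _ => Finset.sum_nonneg fun _ _ => cross_term_nonneg _ _ _

theorem dependsOn_cross {k s N : ℕ} (h : s ≤ N) : DependsOn (· ∈ cross m k s) (Set.Iio N) := by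
  intro x y hxy
  exact propext <| forall₃_congr fun i hi _ => by rw [hxy i (Set.mem_Iio.2 (hi.trans_le h))]

/-- Freeing one coordinate multiplies the measure by at most `m k ≤ b`; boundedness of the group is
used here. -/
theorem haar_cylinder_erase_le [∀ k, NeZero (m k)] {b : ℕ} (hb : ∀ k, m k ≤ b) (k s : ℕ)
    (z : G m) : (haar m).real {x | ∀ i < s, i ≠ k → x i = z i} ≤ b / M m s := by
  have h : {x : G m | ∀ i < s, i ≠ k → x i = z i} =
      {x | ∀ i ∈ (Finset.range s).erase k, x i = z i} := by
    ext x
    simp only [Set.mem_ofPred_eq, Finset.mem_erase, Finset.mem_range]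
    exact forall_congr' fun i => ⟨fun h h' => h h'.2 h'.1, fun h h1 h2 => h ⟨h2, h1⟩⟩
  have hM : (M m s : ℝ)⁻¹ = ∏ i ∈ Finset.range s, (m i : ℝ)⁻¹ := by
    rw [M_eq_prod, Finset.prod_inv_distrib]
    push_cast
    rfl
  have hmb : (m k : ℝ) ≤ b := by exact_mod_cast hb k
  have hpos : (0 : ℝ) < m k := by exact_mod_cast Nat.pos_of_ne_zero (NeZero.ne (m k))
  have h1 : (1 : ℝ) ≤ m k := by exact_mod_cast Nat.pos_of_ne_zero (NeZero.ne (m k))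
  rw [h, haar_cylinder, div_eq_mul_inv, hM]
  have hn : ∀ S : Finset ℕ, 0 ≤ ∏ i ∈ S, (m i : ℝ)⁻¹ := fun S =>
    Finset.prod_nonneg fun _ _ => by positivity
  by_cases hk : k ∈ Finset.range s
  · rw [← Finset.mul_prod_erase _ _ hk, ← mul_assoc]
    refine le_mul_of_one_le_left (hn _) ?_
    rw [← div_eq_mul_inv, one_le_div hpos]
    exact hmb
  · rw [Finset.erase_eq_of_notMem hk]
    exact le_mul_of_one_le_left (hn _) (h1.trans hmb)

theorem haar_sub_mem_cross_le [∀ k, NeZero (m k)] {b : ℕ} (hb : ∀ k, m k ≤ b) (k s : ℕ)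
    (x : G m) : (haar m).real {t | x - t ∈ cross m k s} ≤ b / M m s := by
  refine le_trans (le_of_eq ?_) (haar_cylinder_erase_le hb k s x)
  congr 1
  ext t
  exact forall₃_congr fun i _ _ => by rw [Pi.sub_apply, sub_eq_zero, eq_comm]

theorem haar_mem_cross_sub_le [∀ k, NeZero (m k)] {b : ℕ} (hb : ∀ k, m k ≤ b) (k s : ℕ)
    (y : G m) : (haar m).real {x | x - y ∈ cross m k s} ≤ b / M m s := by
  refine le_trans (le_of_eq ?_) (haar_cylinder_erase_le hb k s y)
  congr 1
  ext t
  exact forall₃_congr fun i _ _ => by rw [Pi.sub_apply, sub_eq_zero]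

theorem measurableSet_sub_mem_cross [∀ k, NeZero (m k)] (k s : ℕ) (x : G m) :
    MeasurableSet {t | x - t ∈ cross m k s} := by
  refine (filtration m).le s _ (measurableSet_filtration fun t u htu ht => ?_)
  intro i hi hik
  have := ht i hi hik
  rw [Pi.sub_apply] at this ⊢
  rwa [← htu i hi]

theorem measurableSet_mem_cross_sub [∀ k, NeZero (m k)] (k s : ℕ) (y : G m) :
    MeasurableSet {x | x - y ∈ cross m k s} := by
  refine (filtration m).le s _ (measurableSet_filtration fun t u htu ht => ?_)
  intro i hi hik
  have := ht i hi hik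
  rw [Pi.sub_apply] at this ⊢
  rwa [← htu i hi]

theorem exists_M_le_lt (hm : ∀ k, 2 ≤ m k) {n : ℕ} (hn : 1 ≤ n) :
    ∃ A, M m A ≤ n ∧ n < M m (A + 1) := by
  classical
  have hex : ∃ A, n < M m (A + 1) := ⟨n, (lt_M hm n).trans_le (M_mono hm n.le_succ)⟩
  refine ⟨Nat.find hex, ?_, Nat.find_spec hex⟩
  rcases h : Nat.find hex with _ | A
  · simpa [M] using hn
  · exact not_lt.1 (Nat.find_min hex (by omega : A < Nat.find hex))

/-- The kernel sum of the cross weights over an interval is controlled by the majorant. -/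
theorem sum_haar_interval_inter_cross_le [∀ k, NeZero (m k)] (hm : ∀ k, 2 ≤ m k) {b : ℕ}
    (hb : ∀ k, m k ≤ b) {N A n : ℕ} (hNA : N ≤ A) (hN : M m N ≤ n) (hA : M m A ≤ n) (x y : G m) :
    ∑ s ∈ Finset.range (A + 1), ∑ k ∈ Finset.range (s + 1), (M m k * M m s : ℝ) *
        (haar m).real (interval m N y ∩ {t | x - t ∈ cross m k s}) ≤
      n * (3 + 4 * b) * (majorant m N (x - y) / (M m N : ℝ) ^ 2) := by
  set w : ℕ → ℕ → ℝ := fun k s => (haar m).real (interval m N y ∩ {t | x - t ∈ cross m k s})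
  have hMN : (0 : ℝ) < M m N := by exact_mod_cast M_pos N
  -- On the interval around `y` the coordinates of `t` below `N` are those of `y`, so the
  -- intersection is empty unless `x - y` satisfies the cross conditions below `j`.
  have hw1 : ∀ k s j, j ≤ s → j ≤ N →
      w k s ≤ (cross m k j).indicator (fun _ => (M m N : ℝ)⁻¹) (x - y) := by
    intro k s j hjs hjN
    by_cases hz : x - y ∈ cross m k j
    · rw [Set.indicator_of_mem hz, ← haar_interval N y]
      exact measureReal_mono Set.inter_subset_left
    · have : interval m N y ∩ {t | x - t ∈ cross m k s} = ∅ := by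
        rw [Set.eq_empty_iff_forall_notMem]
        rintro t ⟨ht, ht'⟩
        refine hz fun i hi hik => ?_
        have := ht' i (by omega) hik
        rw [Pi.sub_apply] at this ⊢
        rwa [← ht i (by omega)]
      simp [w, this, hz]
  -- If the free index `k` is at least `N`, it lifts no condition below `N`, and the measure of the
  -- cross itself gives the sharper factor `b / M_s`.
  have hw2 : ∀ k s, N ≤ k → N ≤ s →
      w k s ≤ (cross m N N).indicator (fun _ => (b : ℝ) / M m s) (x - y) := by
    intro k s hk hs
    by_cases hz : x - y ∈ cross m N N
    · rw [Set.indicator_of_mem hz]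
      exact (measureReal_mono Set.inter_subset_right).trans (haar_sub_mem_cross_le hb k s x)
    · have hz' : x - y ∉ cross m k N := fun h => hz fun i hi _ => h i hi (by omega)
      refine (hw1 k s N hs le_rfl).trans ?_
      simp [hz, hz']
  set J := majorant m N (x - y)
  have hJ0 : 0 ≤ J := majorant_nonneg _ _
  have hJN : ∑ k ∈ Finset.range (N + 1),
      (cross m k N).indicator (fun _ => (M m k * M m N : ℝ)) (x - y) ≤ J :=
    Finset.single_le_sum (f := fun s => ∑ k ∈ Finset.range (s + 1),
      (cross m k s).indicator (fun _ => (M m k * M m s : ℝ)) (x - y))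
      (fun s _ => Finset.sum_nonneg fun _ _ => cross_term_nonneg _ _ _)
      (Finset.self_mem_range_succ N)
  have hJNN : (cross m N N).indicator (fun _ => (M m N * M m N : ℝ)) (x - y) ≤ J :=
    le_trans (Finset.single_le_sum (f := fun k =>
      (cross m k N).indicator (fun _ => (M m k * M m N : ℝ)) (x - y))
      (fun _ _ => cross_term_nonneg _ _ _) (Finset.self_mem_range_succ N)) hJN
  -- The rows `s ≤ N` contribute the `1` in `3 + 4 * b = 1 + 2 * (1 + 2 * b)`. The higher rows
  -- contribute the rest, one factor `2` coming from the sum of the `M_s` up to `M_A ≤ n`.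
  have low : ∑ s ∈ Finset.range (N + 1), ∑ k ∈ Finset.range (s + 1), (M m k * M m s : ℝ) * w k s ≤
      n * (J / (M m N : ℝ) ^ 2) := by
    have h1 : ∑ s ∈ Finset.range (N + 1), ∑ k ∈ Finset.range (s + 1),
        (M m k * M m s : ℝ) * w k s ≤ J * (M m N : ℝ)⁻¹ := by
      simp only [J, majorant, Finset.sum_mul]
      refine Finset.sum_le_sum fun s hs => Finset.sum_le_sum fun k _ => ?_
      refine (mul_le_mul_of_nonneg_left (hw1 k s s le_rfl
        (by simpa [Nat.lt_succ_iff] using hs)) (by positivity)).trans (le_of_eq ?_)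
      by_cases hz : x - y ∈ cross m k s <;> simp [hz]
    refine h1.trans ?_
    have h2 : (M m N : ℝ) ≤ n := by exact_mod_cast hN
    have h3 : J * (M m N : ℝ)⁻¹ = M m N * (J / (M m N : ℝ) ^ 2) := by field_simp
    rw [h3]
    exact mul_le_mul_of_nonneg_right h2 (by positivity)
  have high : ∀ s, N ≤ s → ∑ k ∈ Finset.range (s + 1), (M m k * M m s : ℝ) * w k s ≤
      M m s * ((1 + 2 * b) * (J / (M m N : ℝ) ^ 2)) := by
    intro s hs
    have hMs : (0 : ℝ) < M m s := by exact_mod_cast M_pos s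
    rw [← Finset.sum_range_add_sum_Ico _ (by omega : N ≤ s + 1)]
    have h1 : ∑ k ∈ Finset.range N, (M m k * M m s : ℝ) * w k s ≤
        M m s * (J / (M m N : ℝ) ^ 2) := by
      calc ∑ k ∈ Finset.range N, (M m k * M m s : ℝ) * w k s
          ≤ ∑ k ∈ Finset.range N, M m s / (M m N : ℝ) ^ 2 *
            (cross m k N).indicator (fun _ => (M m k * M m N : ℝ)) (x - y) := by
            refine Finset.sum_le_sum fun k _ => ?_
            refine (mul_le_mul_of_nonneg_left (hw1 k s N hs le_rfl) (by positivity)).trans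
              (le_of_eq ?_)
            by_cases hz : x - y ∈ cross m k N
            · simp only [Set.indicator_of_mem hz]
              field_simp
            · simp [hz]
        _ = M m s / (M m N : ℝ) ^ 2 * ∑ k ∈ Finset.range N,
            (cross m k N).indicator (fun _ => (M m k * M m N : ℝ)) (x - y) := by
            rw [Finset.mul_sum]
        _ ≤ M m s / (M m N : ℝ) ^ 2 * J := by
            refine mul_le_mul_of_nonneg_left (le_trans ?_ hJN) (by positivity)
            rw [Finset.sum_range_succ]
            linarith [cross_term_nonneg N N (x - y)]
        _ = _ := by ring
    have h2 : ∑ k ∈ Finset.Ico N (s + 1), (M m k * M m s : ℝ) * w k s ≤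
        M m s * (2 * b * (J / (M m N : ℝ) ^ 2)) := by
      have hterm : ∀ k ∈ Finset.Ico N (s + 1), (M m k * M m s : ℝ) * w k s ≤
          M m k * (b * (J / (M m N : ℝ) ^ 2)) := by
        intro k hk
        refine (mul_le_mul_of_nonneg_left (hw2 k s (Finset.mem_Ico.1 hk).1 hs)
          (by positivity)).trans ?_
        rw [mul_assoc]
        refine mul_le_mul_of_nonneg_left ?_ (by positivity)
        have : (M m s : ℝ) * (cross m N N).indicator (fun _ => (b : ℝ) / M m s) (x - y) =
            b * ((cross m N N).indicator (fun _ => (M m N * M m N : ℝ)) (x - y) /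
              (M m N : ℝ) ^ 2) := by
          by_cases hz : x - y ∈ cross m N N
          · simp only [Set.indicator_of_mem hz]
            field_simp
          · simp [hz]
        rw [this]
        gcongr
      refine (Finset.sum_le_sum hterm).trans ?_
      rw [← Finset.sum_mul]
      have h3 : ∑ k ∈ Finset.Ico N (s + 1), (M m k : ℝ) ≤ 2 * M m s := by
        refine le_trans ?_ (sum_M_le hm s)
        refine Finset.sum_le_sum_of_subset_of_nonneg ?_ fun _ _ _ => by positivity
        intro k hk
        simp only [Finset.mem_Ico] at hk
        simpa using hk.2
      refine (mul_le_mul_of_nonneg_right h3 (by positivity)).trans (le_of_eq (by ring))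
    refine (add_le_add h1 h2).trans (le_of_eq (by ring))
  rw [← Finset.sum_range_add_sum_Ico _ (by omega : N + 1 ≤ A + 1)]
  have h4 : ∑ s ∈ Finset.Ico (N + 1) (A + 1), ∑ k ∈ Finset.range (s + 1),
      (M m k * M m s : ℝ) * w k s ≤ 2 * n * ((1 + 2 * b) * (J / (M m N : ℝ) ^ 2)) := by
    refine (Finset.sum_le_sum fun s hs => high s (by
      have := (Finset.mem_Ico.1 hs).1; omega)).trans ?_
    rw [← Finset.sum_mul]
    refine mul_le_mul_of_nonneg_right ?_ (by positivity)
    have h5 : ∑ s ∈ Finset.Ico (N + 1) (A + 1), (M m s : ℝ) ≤ 2 * M m A := by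
      refine le_trans ?_ (sum_M_le hm A)
      refine Finset.sum_le_sum_of_subset_of_nonneg ?_ fun _ _ _ => by positivity
      intro k hk
      simp only [Finset.mem_Ico] at hk
      simpa using hk.2
    have h6 : (M m A : ℝ) ≤ n := by exact_mod_cast hA
    linarith
  refine (add_le_add low h4).trans (le_of_eq (by ring))

/-- The constant in the estimate of the Fejér means of an atom. -/
def atomConst (b : ℕ) : ℝ := 4 * b ^ 4 * (3 + 4 * b)

/-- For `n < M_N` the kernel is constant on the support of the atom, and the vanishing mean kills
the integral; in rank `0` this case is only `n = 0`, so no cancellation is needed. For `n ≥ M_N`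
size alone suffices. The factor `n` on the right is the normalization of the Fejér kernel, so the
bound on the means does not depend on `n`. -/
theorem norm_integral_mul_fejer_le [∀ k, NeZero (m k)] (hm : ∀ k, 2 ≤ m k) {b : ℕ}
    (hb : ∀ k, m k ≤ b) {N : ℕ} {y : G m} {B : ℝ} (hB : 0 ≤ B) {a : G m → ℂ}
    (ha : ∀ t, ‖a t‖ ≤ (interval m N y).indicator (fun _ => B) t)
    (h0 : N = 0 ∨ ∫ t, a t ∂(haar m) = 0) (n : ℕ) (x : G m) :
    ‖∫ t, a t * fejer m n (x - t) ∂(haar m)‖ ≤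
      n * (atomConst b * B / (M m N : ℝ) ^ 2 * majorant m N (x - y)) := by
  have hC : 0 ≤ atomConst b := by unfold atomConst; positivity
  have hrhs : 0 ≤ n * (atomConst b * B / (M m N : ℝ) ^ 2 * majorant m N (x - y)) := by
    have := majorant_nonneg N (x - y)
    positivity
  rcases lt_or_ge n (M m N) with hn | hn
  · rcases h0 with rfl | h0
    · have : n = 0 := by simpa [M] using hn
      simp [this, fejer]
    · have h1 : ∀ t, a t * fejer m n (x - t) = a t * fejer m n (x - y) := by
        intro t
        by_cases ht : t ∈ interval m N y
        · congr 1
          refine dependsOn_fejer hm hn.le fun i hi => ?_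
          rw [Pi.sub_apply, Pi.sub_apply, ht i hi]
        · have h2 := ha t
          rw [Set.indicator_of_notMem ht, norm_le_zero_iff] at h2
          simp [h2]
      simp only [h1]
      rw [integral_mul_const, h0, zero_mul, norm_zero]
      exact hrhs
  · have hn1 : 1 ≤ n := le_trans (M_pos N) hn
    obtain ⟨A, hA1, hA2⟩ := exists_M_le_lt hm hn1
    have hNA : N ≤ A := by
      by_contra h
      have := M_mono hm (by omega : A + 1 ≤ N)
      omega
    let g : G m → ℝ := fun t => ∑ s ∈ Finset.range (A + 1), ∑ k ∈ Finset.range (s + 1),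
      B * (4 * b ^ 4) * (M m k * M m s) *
        (interval m N y ∩ {t | x - t ∈ cross m k s}).indicator (fun _ => 1) t
    have hmeas : ∀ k s, MeasurableSet (interval m N y ∩ {t | x - t ∈ cross m k s}) := fun k s =>
      (measurableSet_interval m N y).inter (measurableSet_sub_mem_cross k s x)
    have hint : ∀ k s, Integrable (fun t => B * (4 * b ^ 4) * (M m k * M m s) *
        (interval m N y ∩ {t | x - t ∈ cross m k s}).indicator (fun _ => (1 : ℝ)) t) (haar m) :=
      fun k s => ((integrable_const (1 : ℝ)).indicator (hmeas k s)).const_mul _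
    have hg : Integrable g (haar m) :=
      integrable_finsetSum _ fun s _ => integrable_finsetSum _ fun k _ => hint k s
    have hle : ∀ t, ‖a t * fejer m n (x - t)‖ ≤ g t := by
      intro t
      rw [norm_mul]
      refine (mul_le_mul (ha t) (norm_fejer_le hm hb hA2 (x - t)) (norm_nonneg _)
        (Set.indicator_nonneg (fun _ _ => hB) _)).trans (le_of_eq ?_)
      simp only [g, Finset.mul_sum]
      refine Finset.sum_congr rfl fun s _ => Finset.sum_congr rfl fun k _ => ?_
      by_cases h1 : t ∈ interval m N y <;> by_cases h2 : x - t ∈ cross m k s <;>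
        (simp [Set.indicator, h1, h2]; try ring)
    refine (norm_integral_le_of_norm_le hg (ae_of_all _ hle)).trans ?_
    have hgi : ∫ t, g t ∂(haar m) = B * (4 * b ^ 4) *
        ∑ s ∈ Finset.range (A + 1), ∑ k ∈ Finset.range (s + 1), (M m k * M m s : ℝ) *
        (haar m).real (interval m N y ∩ {t | x - t ∈ cross m k s}) := by
      simp only [g]
      rw [integral_finsetSum _ fun s _ => integrable_finsetSum _ fun k _ => hint k s,
        Finset.mul_sum]
      refine Finset.sum_congr rfl fun s _ => ?_
      rw [integral_finsetSum _ fun k _ => hint k s, Finset.mul_sum]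
      refine Finset.sum_congr rfl fun k _ => ?_
      rw [integral_const_mul, integral_indicator (hmeas k s)]
      simp only [integral_const, smul_eq_mul, mul_one, measureReal_restrict_apply_univ]
      ring
    rw [hgi]
    refine (mul_le_mul_of_nonneg_left
      (sum_haar_interval_inter_cross_le hm hb hNA hn hA1 x y) (by positivity)).trans
      (le_of_eq ?_)
    unfold atomConst
    ring

/-- Truncating each cross term separately and using that its set has measure at most `b / M_s`
reduces this to `sum_sum_min_le`. The bound is uniform in the rank `N`. -/
theorem integral_min_majorant_le [∀ k, NeZero (m k)] (hm : ∀ k, 2 ≤ m k) {b : ℕ}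
    (hb : ∀ k, m k ≤ b) (N : ℕ) (y : G m) {c L : ℝ} (hc : 0 < c) (hL : 0 < L) :
    ∫ x, min (c * majorant m N (x - y)) L ∂(haar m) ≤ 12 * b * √(c * L) := by
  let g : G m → ℝ := fun x => ∑ s ∈ Finset.range (N + 1), ∑ k ∈ Finset.range (s + 1),
    min (c * (M m k * M m s)) L * {x | x - y ∈ cross m k s}.indicator (fun _ => 1) x
  have hint : ∀ k s, Integrable (fun x => min (c * (M m k * M m s)) L *
      {x | x - y ∈ cross m k s}.indicator (fun _ => (1 : ℝ)) x) (haar m) := fun k s =>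
    ((integrable_const (1 : ℝ)).indicator (measurableSet_mem_cross_sub k s y)).const_mul _
  have hg : Integrable g (haar m) :=
    integrable_finsetSum _ fun s _ => integrable_finsetSum _ fun k _ => hint k s
  have hle : ∀ x, min (c * majorant m N (x - y)) L ≤ g x := by
    intro x
    rw [majorant, Finset.mul_sum]
    refine (min_sum_le_sum_min _ _ (fun s _ => mul_nonneg hc.le
      (Finset.sum_nonneg fun _ _ => cross_term_nonneg _ _ _)) hL.le).trans ?_
    refine Finset.sum_le_sum fun s _ => ?_
    rw [Finset.mul_sum]
    refine (min_sum_le_sum_min _ _ (fun k _ => mul_nonneg hc.le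
      (cross_term_nonneg _ _ _)) hL.le).trans ?_
    refine Finset.sum_le_sum fun k _ => le_of_eq ?_
    by_cases h : x - y ∈ cross m k s
    · rw [Set.indicator_of_mem h, Set.indicator_of_mem (by exact h), mul_one]
    · rw [Set.indicator_of_notMem h, Set.indicator_of_notMem (by exact h)]
      simp [hL.le]
  have hMpos : ∀ l, (0 : ℝ) < M m l := fun l => by exact_mod_cast M_pos l
  calc ∫ x, min (c * majorant m N (x - y)) L ∂(haar m) ≤ ∫ x, g x ∂(haar m) := by
        refine integral_mono_of_nonneg (ae_of_all _ fun x => ?_) hg (ae_of_all _ hle)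
        exact le_min (mul_nonneg hc.le (majorant_nonneg _ _)) hL.le
    _ = ∑ s ∈ Finset.range (N + 1), ∑ k ∈ Finset.range (s + 1),
        min (c * (M m k * M m s)) L * (haar m).real {x | x - y ∈ cross m k s} := by
        simp only [g]
        rw [integral_finsetSum _ fun s _ => integrable_finsetSum _ fun k _ => hint k s]
        refine Finset.sum_congr rfl fun s _ => ?_
        rw [integral_finsetSum _ fun k _ => hint k s]
        refine Finset.sum_congr rfl fun k _ => ?_
        rw [integral_const_mul, integral_indicator (measurableSet_mem_cross_sub k s y)]
        simp
    _ ≤ ∑ s ∈ Finset.range (N + 1), ∑ k ∈ Finset.range (s + 1),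
        b * (min (c * (M m k * M m s)) L / M m s) := by
        refine Finset.sum_le_sum fun s _ => Finset.sum_le_sum fun k _ => ?_
        refine (mul_le_mul_of_nonneg_left (haar_mem_cross_sub_le hb k s y)
          (le_min (by positivity) hL.le)).trans (le_of_eq (by ring))
    _ = b * ∑ s ∈ Finset.range (N + 1), ∑ k ∈ Finset.range (s + 1),
        min (c * (M m k * M m s)) L / M m s := by
        simp only [Finset.mul_sum]
    _ ≤ b * (12 * √(c * L)) := by
        refine mul_le_mul_of_nonneg_left (sum_sum_min_le hMpos (fun l => ?_) hc hL _)
          (by positivity)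
        exact_mod_cast two_mul_M_le hm l
    _ = 12 * b * √(c * L) := by ring

/-- Weak type estimate for superpositions of translated majorants. -/
theorem haar_le_sum_majorant [∀ k, NeZero (m k)] (hm : ∀ k, 2 ≤ m k) {b : ℕ}
    (hb : ∀ k, m k ≤ b) {ι : Type*} (s : Finset ι) (N : ι → ℕ) (y : ι → G m) (c : ι → ℝ)
    (hc : ∀ i ∈ s, 0 < c i) {L : ℝ} (hL : 0 < L) :
    L * (haar m).real {x | L ≤ ∑ i ∈ s, c i * majorant m (N i) (x - y i)} ≤
      ∑ i ∈ s, 12 * b * √(c i * L) := by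
  have hdep : ∀ i, DependsOn (fun x => min (c i * majorant m (N i) (x - y i)) L)
      (Set.Iio (N i)) := by
    intro i x z hxz
    have : majorant m (N i) (x - y i) = majorant m (N i) (z - y i) := by
      refine Finset.sum_congr rfl fun s hs => Finset.sum_congr rfl fun k _ => ?_
      have h : (x - y i ∈ cross m k s) = (z - y i ∈ cross m k s) :=
        dependsOn_cross (N := N i) (by simpa [Nat.lt_succ_iff] using hs) fun j hj => by
          rw [Pi.sub_apply, Pi.sub_apply, hxz j hj]
      by_cases h' : x - y i ∈ cross m k s
      · rw [Set.indicator_of_mem h', Set.indicator_of_mem (h ▸ h')]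
      · rw [Set.indicator_of_notMem h', Set.indicator_of_notMem (h ▸ h')]
    simp only [this]
  have hint : ∀ i, Integrable (fun x => min (c i * majorant m (N i) (x - y i)) L) (haar m) :=
    fun i => (hdep i).integrable
  have hnn : ∀ i ∈ s, ∀ x, 0 ≤ c i * majorant m (N i) (x - y i) := fun i hi x =>
    mul_nonneg (hc i hi).le (majorant_nonneg _ _)
  -- Where the full sum reaches `L`, so does the sum of the terms truncated at `L`; Markov's
  -- inequality is applied to the latter.
  have hsub : {x | L ≤ ∑ i ∈ s, c i * majorant m (N i) (x - y i)} ⊆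
      {x | L ≤ ∑ i ∈ s, min (c i * majorant m (N i) (x - y i)) L} := by
    intro x hx
    have := min_sum_le_sum_min s _ (fun i hi => hnn i hi x) hL.le
    rwa [min_eq_right hx] at this
  calc L * (haar m).real {x | L ≤ ∑ i ∈ s, c i * majorant m (N i) (x - y i)}
      ≤ L * (haar m).real {x | L ≤ ∑ i ∈ s, min (c i * majorant m (N i) (x - y i)) L} :=
        mul_le_mul_of_nonneg_left (measureReal_mono hsub) hL.le
    _ ≤ ∫ x, ∑ i ∈ s, min (c i * majorant m (N i) (x - y i)) L ∂(haar m) :=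
        mul_meas_ge_le_integral_of_nonneg (ae_of_all _ fun x =>
          Finset.sum_nonneg fun i hi => le_min (hnn i hi x) hL.le)
          (integrable_finsetSum _ fun i _ => hint i) L
    _ = ∑ i ∈ s, ∫ x, min (c i * majorant m (N i) (x - y i)) L ∂(haar m) :=
        integral_finsetSum _ fun i _ => hint i
    _ ≤ ∑ i ∈ s, 12 * b * √(c i * L) :=
        Finset.sum_le_sum fun i hi => integral_min_majorant_le hm hb _ _ (hc i hi) hL

end Atoms

/-! ### Predictable stopping times and control by the maximal function. -/

section Stopping

variable {m : ℕ → ℕ}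

/-- Some child of the interval of rank `n` around `x` carries a value of `f` larger than `θ`. -/
def Exceeds (f : ℕ → G m → ℂ) (θ : ℝ) (n : ℕ) (x : G m) : Prop :=
  ∃ y ∈ interval m n x, θ < ‖f (n + 1) y‖

/-- The predictable stopping time at the level `θ`, bounded by `N`. -/
def stopTime (f : ℕ → G m → ℂ) (N : ℕ) (θ : ℝ) (x : G m) : ℕ :=
  sInf {n | n = N ∨ Exceeds f θ n x}

variable {f : ℕ → G m → ℂ} {N : ℕ} {θ : ℝ}

theorem exceeds_congr {n : ℕ} {x y : G m} (hxy : ∀ i < n, x i = y i) :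
    Exceeds f θ n x ↔ Exceeds f θ n y := by
  have : interval m n x = interval m n y := by
    ext z
    exact forall₂_congr fun i hi => by rw [hxy i hi]
  rw [Exceeds, this, Exceeds]

theorem stopTime_le (x : G m) : stopTime f N θ x ≤ N := Nat.sInf_le (Or.inl rfl)

theorem stopTime_mem (x : G m) : stopTime f N θ x = N ∨ Exceeds f θ (stopTime f N θ x) x :=
  Nat.sInf_mem (s := {n | n = N ∨ Exceeds f θ n x}) ⟨N, Or.inl rfl⟩

theorem not_exceeds_of_lt_stopTime {n : ℕ} {x : G m} (h : n < stopTime f N θ x) : ¬ Exceeds f θ n x :=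
  fun h' => Nat.notMem_of_lt_sInf h (Or.inr h')

theorem stopTime_mono {θ' : ℝ} (h : θ ≤ θ') (x : G m) : stopTime f N θ x ≤ stopTime f N θ' x := by
  refine Nat.sInf_le ?_
  rcases stopTime_mem (f := f) (N := N) (θ := θ') x with h' | ⟨y, hy, h'⟩
  · exact Or.inl h'
  · exact Or.inr ⟨y, hy, h.trans_lt h'⟩

/-- Predictability: `Exceeds` at rank `n` depends only on the interval of rank `n`, so stopping at
`n` is decided by the coordinates below `n`. -/
theorem stopTime_congr {x y : G m} (hxy : ∀ i < stopTime f N θ x, x i = y i) :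
    stopTime f N θ y = stopTime f N θ x := by
  have h1 : stopTime f N θ y ≤ stopTime f N θ x :=
    Nat.sInf_le ((stopTime_mem x).imp_right (exceeds_congr hxy).1)
  refine le_antisymm h1 (Nat.sInf_le ((stopTime_mem y).imp_right ?_))
  exact (exceeds_congr fun i hi => hxy i (hi.trans_le h1)).2

theorem min_stopTime_congr {n : ℕ} {x y : G m} (hxy : ∀ i < n, x i = y i) :
    min (stopTime f N θ x) n = min (stopTime f N θ y) n := by
  rcases le_total (stopTime f N θ x) n with h | h
  · rw [stopTime_congr fun i hi => hxy i (hi.trans_le h)]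
  · rcases le_total (stopTime f N θ y) n with h' | h'
    · rw [stopTime_congr fun i hi => (hxy i (hi.trans_le h')).symm]
    · rw [min_eq_right h, min_eq_right h']

/-- Stopping one step before the level is passed prevents any overshoot. Rank `0` has no
predecessor, hence the separate assumption on `f 0`. -/
theorem norm_apply_stopTime_le {x : G m} (h0 : ‖f 0 x‖ ≤ θ) : ‖f (stopTime f N θ x) x‖ ≤ θ := by
  rcases h : stopTime f N θ x with _ | n
  · exact h0
  · by_contra h'
    exact not_exceeds_of_lt_stopTime (f := f) (N := N) (θ := θ) (n := n) (x := x) (by omega)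
      ⟨x, fun _ _ => rfl, not_le.1 h'⟩

theorem stopTime_eq_of_norm_le (h : ∀ n ≤ N, ∀ x, ‖f n x‖ ≤ θ) (x : G m) : stopTime f N θ x = N := by
  rcases stopTime_mem (f := f) (N := N) (θ := θ) x with h' | ⟨y, _, h'⟩
  · exact h'
  · by_contra hne
    have := stopTime_le (f := f) (N := N) (θ := θ) x
    exact absurd (h _ (by omega) y) (not_le.2 h')

theorem dependsOn_apply_min_stopTime (hf : ∀ n, DependsOn (f n) (Set.Iio n)) (n : ℕ) :
    DependsOn (fun x => f (min (stopTime f N θ x) n) x) (Set.Iio n) := by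
  intro x y hxy
  simp only [min_stopTime_congr (f := f) (N := N) (θ := θ) hxy]
  exact hf _ fun i hi => hxy i (Set.mem_Iio.2 (lt_of_lt_of_le (Set.mem_Iio.1 hi) (min_le_right _ _)))

theorem dependsOn_apply_stopTime (hf : ∀ n, DependsOn (f n) (Set.Iio n)) :
    DependsOn (fun x => f (stopTime f N θ x) x) (Set.Iio N) := by
  have h := dependsOn_apply_min_stopTime (N := N) (θ := θ) hf N
  simpa only [min_eq_left (stopTime_le _)] using h

/-- Optional stopping on an interval on which the stopping time is at least its rank. -/
theorem setIntegral_apply_stopTime [∀ k, NeZero (m k)] (hf : Martingale f (filtration m) (haar m))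
    {j : ℕ} (hj : j ≤ N) (y : G m) (hy : ∀ x ∈ interval m j y, j ≤ stopTime f N θ x) :
    ∫ x in interval m j y, f (stopTime f N θ x) x ∂(haar m) =
      ∫ x in interval m j y, f j x ∂(haar m) := by
  have hdep : ∀ n, DependsOn (f n) (Set.Iio n) := fun n => dependsOn_of_stronglyMeasurable (hf.1 n)
  have key : ∀ n, j ≤ n → ∫ x in interval m j y, f (min (stopTime f N θ x) n) x ∂(haar m) =
      ∫ x in interval m j y, f j x ∂(haar m) := by
    intro n hn
    induction n, hn using Nat.le_induction with
    | base =>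
      refine setIntegral_congr_fun (measurableSet_interval m j y) fun x hx => ?_
      simp only [min_eq_right (hy x hx)]
    | succ n hn ih =>
      rw [← ih, ← sub_eq_zero, ← integral_sub
        (dependsOn_apply_min_stopTime hdep (n + 1)).integrable.integrableOn
        (dependsOn_apply_min_stopTime hdep n).integrable.integrableOn]
      -- The stopped process moves from `n` to `n + 1` only on this set, which lies in `F_n`; there
      -- the martingale increment integrates to zero.
      have hs : MeasurableSet[filtration m n] {x | n < stopTime f N θ x} := by
        refine measurableSet_filtration fun x z hxz hx => ?_
        by_contra hz
        have := stopTime_congr (f := f) (N := N) (θ := θ) (x := z) (y := x)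
          fun i hi => (hxz i (hi.trans_le (not_lt.1 hz))).symm
        exact hz (show n < stopTime f N θ z by rw [← this]; exact hx)
      have h1 : ∀ x, f (min (stopTime f N θ x) (n + 1)) x - f (min (stopTime f N θ x) n) x =
          {x | n < stopTime f N θ x}.indicator (fun x => f (n + 1) x - f n x) x := by
        intro x
        by_cases hx : n < stopTime f N θ x
        · rw [Set.indicator_of_mem (by exact hx), min_eq_right (by omega), min_eq_right hx.le]
        · rw [Set.indicator_of_notMem (by exact hx), min_eq_left (by omega),
            min_eq_left (by omega), sub_self]
      simp only [h1]
      rw [setIntegral_indicator ((filtration m).le n _ hs),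
        integral_sub (hf.integrable _).integrableOn (hf.integrable _).integrableOn, sub_eq_zero]
      have hI : MeasurableSet[filtration m n] (interval m j y) :=
        (filtration m).mono hn _ (measurableSet_interval_filtration j y)
      exact (hf.setIntegral_eq n.le_succ (MeasurableSet.inter hI hs)).symm
  have h := key N hj
  simpa only [min_eq_left (stopTime_le _)] using h

open Classical in
/-- The maximal intervals, given by rank and representative, on which the stopping time at the
level `θ` is attained before `N`. -/
def stopIntervals [∀ k, NeZero (m k)] (f : ℕ → G m → ℂ) (N : ℕ) (θ : ℝ) :
    Finset (Σ _ : ℕ, G m) :=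
  (Finset.range N).sigma fun j => {y ∈ reps m j | stopTime f N θ y = j}

theorem mem_stopIntervals [∀ k, NeZero (m k)] {p : Σ _ : ℕ, G m} :
    p ∈ stopIntervals f N θ ↔ p.1 < N ∧ p.2 ∈ reps m p.1 ∧ stopTime f N θ p.2 = p.1 := by
  simp [stopIntervals]

theorem stopTime_eq_of_mem_interval [∀ k, NeZero (m k)] {p : Σ _ : ℕ, G m}
    (hp : p ∈ stopIntervals f N θ) {x : G m} (hx : x ∈ interval m p.1 p.2) :
    stopTime f N θ x = p.1 := by
  obtain ⟨_, _, h3⟩ := mem_stopIntervals.1 hp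
  rw [← h3]
  exact stopTime_congr fun i hi => (hx i (h3 ▸ hi)).symm

/-- The stopping intervals are pairwise disjoint and partition the set where stopping occurs before
`N`. -/
theorem sum_indicator_stopIntervals [∀ k, NeZero (m k)] {E : Type*} [AddCommMonoid E]
    (g : G m → E) (x : G m) :
    ∑ p ∈ stopIntervals f N θ, (interval m p.1 p.2).indicator g x =
      if stopTime f N θ x < N then g x else 0 := by
  split_ifs with h
  · have hx : x ∈ interval m (stopTime f N θ x) (trunc (stopTime f N θ x) x) := fun i hi =>
      (trunc_apply_of_lt hi x).symm
    rw [Finset.sum_eq_single ⟨stopTime f N θ x, trunc (stopTime f N θ x) x⟩]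
    · rw [Set.indicator_of_mem hx]
    · rintro ⟨j, y⟩ hp hne
      refine Set.indicator_of_notMem (fun hxy => hne ?_) _
      have h1 := stopTime_eq_of_mem_interval hp hxy
      obtain ⟨_, h2, _⟩ := mem_stopIntervals.1 hp
      simp only at h1 h2 hxy
      rw [mem_interval_iff_trunc_eq h2] at hxy
      subst h1
      rw [hxy]
    · intro hn
      refine absurd (mem_stopIntervals.2 ⟨h, trunc_mem_reps _ _, ?_⟩) hn
      exact stopTime_congr fun i hi => (trunc_apply_of_lt hi x).symm
  · refine Finset.sum_eq_zero fun p hp => Set.indicator_of_notMem (fun hx => h ?_) _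
    rw [stopTime_eq_of_mem_interval hp hx]
    exact (mem_stopIntervals.1 hp).1

/-- The truncated maximal function of a sequence of functions. -/
def maxNorm (f : ℕ → G m → ℂ) (N : ℕ) (x : G m) : ℝ≥0 :=
  (Finset.range (N + 1)).sup fun n => ‖f n x‖₊

theorem norm_le_maxNorm {n : ℕ} (hn : n ≤ N) (x : G m) : ‖f n x‖ ≤ maxNorm f N x := by
  have : ‖f n x‖₊ ≤ maxNorm f N x :=
    Finset.le_sup (f := fun n => ‖f n x‖₊) (by simpa [Nat.lt_succ_iff] using hn)
  exact_mod_cast this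

theorem dependsOn_maxNorm (hf : ∀ n, DependsOn (f n) (Set.Iio n)) :
    DependsOn (maxNorm f N) (Set.Iio N) := by
  intro x y hxy
  refine Finset.sup_congr rfl fun n hn => ?_
  rw [hf n fun i hi => hxy i (lt_of_lt_of_le hi (by simpa [Nat.lt_succ_iff] using hn))]

theorem measurableSet_lt_maxNorm [∀ k, NeZero (m k)] (hf : ∀ n, DependsOn (f n) (Set.Iio n)) :
    MeasurableSet {x | θ < maxNorm f N x} := by
  refine (filtration m).le N _ (measurableSet_filtration fun x y hxy hx => ?_)
  rwa [Set.mem_ofPred_eq, ← dependsOn_maxNorm hf hxy]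

/-- The stopping intervals are controlled by the maximal function. -/
theorem sum_stopIntervals_le [∀ k, NeZero (m k)] {b : ℕ} (hb : ∀ k, m k ≤ b)
    (hf : ∀ n, DependsOn (f n) (Set.Iio n)) :
    ∑ p ∈ stopIntervals f N θ, (M m p.1 : ℝ)⁻¹ ≤ b * (haar m).real {x | θ < maxNorm f N x} := by
  have hE := measurableSet_lt_maxNorm (N := N) (θ := θ) hf
  set E := {x | θ < maxNorm f N x}
  -- A stopping interval has a child on which the next member of the sequence exceeds `θ`, and a
  -- child occupies at least the fraction `1 / b` of its parent.
  have h1 : ∀ p ∈ stopIntervals f N θ,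
      (M m p.1 : ℝ)⁻¹ ≤ b * (haar m).real (interval m p.1 p.2 ∩ E) := by
    rintro ⟨j, y⟩ hp
    obtain ⟨hj, _, hs⟩ := mem_stopIntervals.1 hp
    simp only at hj hs ⊢
    have hex : Exceeds f θ j y := by
      have := stopTime_mem (f := f) (N := N) (θ := θ) y
      rw [hs] at this
      exact this.resolve_left hj.ne
    obtain ⟨z, hz, hlt⟩ := hex
    have hsub : interval m (j + 1) z ⊆ interval m j y ∩ E := by
      intro x hx
      refine ⟨fun i hi => (hx i (by omega)).trans (hz i hi), ?_⟩
      refine lt_of_lt_of_le ?_ (norm_le_maxNorm (f := f) (by omega : j + 1 ≤ N) x)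
      rwa [hf (j + 1) (fun i hi => hx i hi)]
    have h2 := measureReal_mono (μ := haar m) hsub
    rw [haar_interval] at h2
    refine le_trans ?_ (mul_le_mul_of_nonneg_left h2 (by positivity))
    have hMj : (0 : ℝ) < M m j := by exact_mod_cast M_pos j
    have hmj : (0 : ℝ) < m j := by exact_mod_cast Nat.pos_of_ne_zero (NeZero.ne (m j))
    have hbj : (m j : ℝ) ≤ b := by exact_mod_cast hb j
    rw [M_succ]
    push_cast
    rw [mul_inv, ← mul_assoc]
    refine le_mul_of_one_le_left (by positivity) ?_
    rw [← div_eq_mul_inv, one_le_div hmj]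
    exact hbj
  refine (Finset.sum_le_sum h1).trans ?_
  rw [← Finset.mul_sum]
  refine mul_le_mul_of_nonneg_left ?_ (by positivity)
  have h3 : ∀ p : Σ _ : ℕ, G m, (haar m).real (interval m p.1 p.2 ∩ E) =
      ∫ x, (interval m p.1 p.2).indicator (E.indicator fun _ => (1 : ℝ)) x ∂(haar m) := by
    intro p
    rw [Set.indicator_indicator,
      integral_indicator ((measurableSet_interval m p.1 p.2).inter hE)]
    simp
  have hint : Integrable (E.indicator fun _ => (1 : ℝ)) (haar m) :=
    (integrable_const 1).indicator hE
  simp only [h3]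
  rw [← integral_finsetSum _ fun p _ => hint.indicator (measurableSet_interval m p.1 p.2)]
  have h4 : (haar m).real E = ∫ x, E.indicator (fun _ => (1 : ℝ)) x ∂(haar m) := by
    rw [integral_indicator hE]
    simp
  rw [h4]
  refine integral_mono_of_nonneg (ae_of_all _ fun x => Finset.sum_nonneg fun p _ =>
    Set.indicator_nonneg (fun _ _ => Set.indicator_nonneg (fun _ _ => zero_le_one) _) _) hint
    (ae_of_all _ fun x => ?_)
  simp only [sum_indicator_stopIntervals]
  split_ifs
  · exact le_rfl
  · exact Set.indicator_nonneg (fun _ _ => zero_le_one) _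

/-- A geometric sum is at most twice its last term, and the last `k` that counts satisfies `2 ^ k <
√u`. -/
theorem sum_two_pow_le_sqrt {u : ℝ} (K : ℕ) :
    ∑ k ∈ Finset.range K, (if (4 : ℝ) ^ k < u then (2 : ℝ) ^ k else 0) ≤ 2 * √u := by
  induction K with
  | zero => simp
  | succ K ih =>
    by_cases h : (4 : ℝ) ^ K < u
    · calc ∑ k ∈ Finset.range (K + 1), (if (4 : ℝ) ^ k < u then (2 : ℝ) ^ k else 0)
          ≤ ∑ k ∈ Finset.range (K + 1), (2 : ℝ) ^ k := by
            refine Finset.sum_le_sum fun k _ => ?_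
            split_ifs
            · exact le_rfl
            · positivity
        _ ≤ 2 * 2 ^ K := by
            rw [geom_sum_eq (by norm_num), pow_succ]
            linarith
        _ ≤ 2 * √u := by
            refine mul_le_mul_of_nonneg_left (Real.le_sqrt_of_sq_le ?_) (by norm_num)
            rw [← pow_mul, mul_comm, pow_mul]
            norm_num
            exact h.le
    · rw [Finset.sum_range_succ, if_neg h, add_zero]
      exact ih

/-- A discrete layer-cake formula for the square root of the maximal function along the levels `L *
4 ^ k`. -/
theorem sum_two_pow_mul_haar_le [∀ k, NeZero (m k)] (hf : ∀ n, DependsOn (f n) (Set.Iio n))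
    {L : ℝ} (hL : 0 < L) (K : ℕ) :
    √L * ∑ k ∈ Finset.range K, 2 ^ k * (haar m).real {x | L * 4 ^ k < maxNorm f N x} ≤
      2 * ∫ x, √(maxNorm f N x) ∂(haar m) := by
  have hmeas : ∀ k : ℕ, MeasurableSet {x | L * 4 ^ k < maxNorm f N x} := fun k =>
    measurableSet_lt_maxNorm hf
  have hint : ∀ k : ℕ, Integrable (fun x => √L * (2 ^ k *
      {x | L * 4 ^ k < maxNorm f N x}.indicator (fun _ => (1 : ℝ)) x)) (haar m) := fun k =>
    (((integrable_const (1 : ℝ)).indicator (hmeas k)).const_mul _).const_mul _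
  have hdep : DependsOn (fun x => √(maxNorm f N x)) (Set.Iio N) := fun x y hxy => by
    simp only [dependsOn_maxNorm hf hxy]
  calc √L * ∑ k ∈ Finset.range K, 2 ^ k * (haar m).real {x | L * 4 ^ k < maxNorm f N x}
      = ∫ x, ∑ k ∈ Finset.range K, √L * (2 ^ k *
        {x | L * 4 ^ k < maxNorm f N x}.indicator (fun _ => (1 : ℝ)) x) ∂(haar m) := by
        rw [integral_finsetSum _ fun k _ => hint k, Finset.mul_sum]
        refine Finset.sum_congr rfl fun k _ => ?_
        rw [integral_const_mul, integral_const_mul, integral_indicator (hmeas k)]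
        simp
    _ ≤ ∫ x, 2 * √(maxNorm f N x) ∂(haar m) := by
        refine integral_mono (integrable_finsetSum _ fun k _ => hint k)
          (hdep.integrable.const_mul _) fun x => ?_
        simp only
        rw [← Finset.mul_sum]
        have h := sum_two_pow_le_sqrt (u := maxNorm f N x / L) K
        have h2 : ∀ k ∈ Finset.range K, (2 : ℝ) ^ k *
            {x | L * 4 ^ k < maxNorm f N x}.indicator (fun _ => (1 : ℝ)) x =
            if (4 : ℝ) ^ k < maxNorm f N x / L then (2 : ℝ) ^ k else 0 := by
          intro k _
          simp only [lt_div_iff₀' hL, Set.indicator, Set.mem_ofPred_eq, mul_ite, mul_one, mul_zero]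
        rw [Finset.sum_congr rfl h2]
        calc _ ≤ √L * (2 * √(maxNorm f N x / L)) :=
              mul_le_mul_of_nonneg_left h (Real.sqrt_nonneg _)
          _ = 2 * √(maxNorm f N x) := by
              rw [Real.sqrt_div' _ hL.le]
              have := Real.sqrt_pos.2 hL
              field_simp
    _ = 2 * ∫ x, √(maxNorm f N x) ∂(haar m) := integral_const_mul _ _

end Stopping

/-! ### Atomic decomposition and the weak type estimate for Fejér means. -/

section WeakType

variable {m : ℕ → ℕ} {f : ℕ → G m → ℂ}

theorem integrable_mul_fejer [∀ k, NeZero (m k)] (hm : ∀ k, 2 ≤ m k) {N : ℕ} {g : G m → ℂ}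
    (hg : DependsOn g (Set.Iio N)) (n : ℕ) (x : G m) :
    Integrable (fun t => g t * fejer m n (x - t)) (haar m) := by
  refine DependsOn.integrable (n := max N n) fun t u htu => ?_
  have h1 : g t = g u := hg fun i hi => htu i (Set.mem_Iio.2 (lt_of_lt_of_le (Set.mem_Iio.1 hi) (le_max_left _ _)))
  have h2 : fejer m n (x - t) = fejer m n (x - u) :=
    dependsOn_fejer hm (lt_M hm n).le fun i hi => by
      rw [Pi.sub_apply, Pi.sub_apply, htu i (Set.mem_Iio.2 (lt_of_lt_of_le (Set.mem_Iio.1 hi) (le_max_right _ _)))]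
  simp only [h1, h2]

theorem dependsOn_indicator_interval {E : Type*} [Zero E] {N j : ℕ} (hj : j ≤ N) (y : G m)
    {g : G m → E} (hg : DependsOn g (Set.Iio N)) :
    DependsOn ((interval m j y).indicator g) (Set.Iio N) := by
  intro t u htu
  have h : t ∈ interval m j y ↔ u ∈ interval m j y :=
    forall₂_congr fun i hi => by rw [htu i (Set.mem_Iio.2 (hi.trans_le hj))]
  by_cases ht : t ∈ interval m j y
  · rw [Set.indicator_of_mem ht, Set.indicator_of_mem (h.1 ht), hg htu]
  · rw [Set.indicator_of_notMem ht, Set.indicator_of_notMem (mt h.2 ht)]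

/-- The constant in the weak type estimate. -/
def weakConst (b : ℕ) : ℝ := 24 * b ^ 2 * √(5 * atomConst b) + 1

/-- The family of all stopping intervals for the levels `L * 4 ^ k`, `k < K`. -/
def levelIntervals [∀ k, NeZero (m k)] (f : ℕ → G m → ℂ) (N : ℕ) (L : ℝ) (K : ℕ) :
    Finset (Σ _ : ℕ, Σ _ : ℕ, G m) :=
  (Finset.range K).sigma fun k => stopIntervals f N (L * 4 ^ k)

theorem exists_norm_le_mul_four_pow [∀ k, NeZero (m k)] (hf : ∀ n, DependsOn (f n) (Set.Iio n))
    (N : ℕ) {L : ℝ} (hL : 0 < L) : ∃ K : ℕ, ∀ n ≤ N, ∀ x, ‖f n x‖ ≤ L * 4 ^ K := by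
  have hdep : DependsOn (fun x => (maxNorm f N x : ℝ)) (Set.Iio N) := fun x y hxy => by
    simp only [dependsOn_maxNorm hf hxy]
  obtain ⟨C, hC⟩ := hdep.exists_norm_le
  obtain ⟨K, hK⟩ := pow_unbounded_of_one_lt (C / L) (by norm_num : (1 : ℝ) < 4)
  refine ⟨K, fun n hn x => (norm_le_maxNorm hn x).trans ((le_abs_self _).trans ((hC x).trans ?_))⟩
  rw [div_lt_iff₀ hL] at hK
  linarith

/-- Calderón-Zygmund type estimate of the Fejér sums of a bounded-level martingale. -/
theorem norm_integral_martingale_mul_fejer_le [∀ k, NeZero (m k)] (hm : ∀ k, 2 ≤ m k) {b : ℕ}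
    (hb : ∀ k, m k ≤ b) (hf : Martingale f (filtration m) (haar m)) {N : ℕ} {L : ℝ} (hL : 0 < L)
    (h0 : ∀ x, ‖f 0 x‖ ≤ L) {K : ℕ} (hK : ∀ n ≤ N, ∀ x, ‖f n x‖ ≤ L * 4 ^ K) (n : ℕ) (x : G m) :
    ‖∫ t, f N t * fejer m n (x - t) ∂(haar m)‖ ≤
      n * (atomConst b * L + ∑ i ∈ levelIntervals f N L K,
        atomConst b * (5 * L * 4 ^ i.1) / (M m i.2.1 : ℝ) ^ 2 *
          majorant m i.2.1 (x - i.2.2)) := by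
  have hdep : ∀ n, DependsOn (f n) (Set.Iio n) := fun n => dependsOn_of_stronglyMeasurable (hf.1 n)
  have hlev : ∀ k : ℕ, L ≤ L * 4 ^ k := fun k =>
    le_mul_of_one_le_right hL.le (one_le_pow₀ (by norm_num))
  let P : ℕ → G m → ℂ := fun k t => f (stopTime f N (L * 4 ^ k) t) t
  have hP : ∀ k, DependsOn (P k) (Set.Iio N) := fun k => dependsOn_apply_stopTime hdep
  have hPn : ∀ k t, ‖P k t‖ ≤ L * 4 ^ k := fun k t => norm_apply_stopTime_le ((h0 t).trans (hlev k))
  -- The increments between consecutive stopped functions, cut to the stopping intervals of the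
  -- lower level, are the atoms. Their height is `4 + 1 = 5` times `L * 4 ^ k`.
  let d : ℕ → G m → ℂ := fun k t => P (k + 1) t - P k t
  have hd : ∀ k, DependsOn (d k) (Set.Iio N) := fun k t u htu => by
    simp only [d, hP k htu, hP (k + 1) htu]
  have hdn : ∀ k t, ‖d k t‖ ≤ 5 * L * 4 ^ k := fun k t => by
    refine (norm_sub_le _ _).trans ((add_le_add (hPn (k + 1) t) (hPn k t)).trans (le_of_eq ?_))
    ring
  have hmonotone : ∀ k t, stopTime f N (L * 4 ^ k) t ≤ stopTime f N (L * 4 ^ (k + 1)) t := fun k t =>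
    stopTime_mono (mul_le_mul_of_nonneg_left (pow_le_pow_right₀ (by norm_num) k.le_succ) hL.le) t
  let a : (Σ _ : ℕ, Σ _ : ℕ, G m) → G m → ℂ := fun i =>
    (interval m i.2.1 i.2.2).indicator (d i.1)
  have hmem : ∀ i ∈ levelIntervals f N L K, i.2 ∈ stopIntervals f N (L * 4 ^ i.1) := fun i hi =>
    (Finset.mem_sigma.1 hi).2
  -- At level `K` nothing is stopped before `N`, so the increments telescope to `f N`. Where level
  -- `k` does not stop before `N`, neither does level `k + 1`, and the increment vanishes.
  have hsum : ∀ t, f N t = P 0 t + ∑ i ∈ levelIntervals f N L K, a i t := by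
    intro t
    have h1 : f N t = P K t := by simp only [P, stopTime_eq_of_norm_le hK t]
    have h2 : ∀ k, ∑ p ∈ stopIntervals f N (L * 4 ^ k), a ⟨k, p⟩ t = d k t := by
      intro k
      simp only [a]
      rw [sum_indicator_stopIntervals]
      split_ifs with h
      · rfl
      · have h3 := hmonotone k t
        have h4 := stopTime_le (f := f) (N := N) (θ := L * 4 ^ (k + 1)) t
        simp only [d, P]
        rw [show stopTime f N (L * 4 ^ (k + 1)) t = stopTime f N (L * 4 ^ k) t by omega, sub_self]
    rw [levelIntervals, Finset.sum_sigma, Finset.sum_congr rfl fun k _ => h2 k, h1]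
    simp only [d]
    rw [Finset.sum_range_sub (fun k => P k t)]
    ring
  have ha : ∀ i ∈ levelIntervals f N L K, DependsOn (a i) (Set.Iio N) := fun i hi =>
    dependsOn_indicator_interval (mem_stopIntervals.1 (hmem i hi)).1.le _ (hd _)
  have hint : ∫ t, f N t * fejer m n (x - t) ∂(haar m) =
      ∫ t, P 0 t * fejer m n (x - t) ∂(haar m) +
        ∑ i ∈ levelIntervals f N L K, ∫ t, a i t * fejer m n (x - t) ∂(haar m) := by
    simp only [hsum, add_mul, Finset.sum_mul]
    rw [integral_add (integrable_mul_fejer hm (hP 0) n x)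
      (integrable_finsetSum _ fun i hi => integrable_mul_fejer hm (ha i hi) n x),
      integral_finsetSum _ fun i hi => integrable_mul_fejer hm (ha i hi) n x]
  rw [hint, mul_add, Finset.mul_sum]
  refine (norm_add_le _ _).trans (add_le_add ?_ (norm_sum_le_of_le _ fun i hi => ?_))
  -- The bounded part is treated as an atom of rank `0`, whose interval is the whole group; any
  -- centre will do.
  · have h1 := norm_integral_mul_fejer_le hm hb (N := 0) (y := x) hL.le (a := P 0)
      (fun t => by
        rw [Set.indicator_of_mem (show t ∈ interval m 0 x from fun i hi => by omega)]
        simpa using hPn 0 t) (Or.inl rfl) n x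
    have h2 : majorant m 0 (x - x) = 1 := by
      simp [majorant, cross, M]
    rw [h2] at h1
    simpa [M] using h1
  · refine norm_integral_mul_fejer_le hm hb (by positivity) (fun t => ?_) (Or.inr ?_) n x
    · by_cases ht : t ∈ interval m i.2.1 i.2.2
      · simpa [a, ht] using hdn i.1 t
      · simp [a, ht]
    -- The atom has mean zero: on its interval both stopping times are at least the rank, so
    -- optional stopping gives both stopped functions the integral of the martingale at that rank.
    · have hi' := hmem i hi
      have hj := (mem_stopIntervals.1 hi').1.le
      simp only [a, d]
      rw [integral_indicator (measurableSet_interval _ _ _),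
        integral_sub (hP _).integrable.integrableOn (hP _).integrable.integrableOn, sub_eq_zero]
      rw [setIntegral_apply_stopTime hf hj, setIntegral_apply_stopTime hf hj]
      · exact fun t ht => (stopTime_eq_of_mem_interval hi' ht).ge
      · exact fun t ht => (stopTime_eq_of_mem_interval hi' ht).ge.trans (hmonotone _ t)

/-- In the level `(atomConst b + 1) * L`, the part `atomConst b * L` absorbs the bounded part of the
decomposition, leaving `L` for the atoms. -/
theorem sqrt_mul_haar_fejer_gt_le [∀ k, NeZero (m k)] (hm : ∀ k, 2 ≤ m k) {b : ℕ}
    (hb : ∀ k, m k ≤ b) (hf : Martingale f (filtration m) (haar m)) (N : ℕ) {L : ℝ} (hL : 0 < L) :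
    √L * (haar m).real {x | ∃ n : ℕ, n * ((atomConst b + 1) * L) <
        ‖∫ t, f N t * fejer m n (x - t) ∂(haar m)‖} ≤
      weakConst b * ∫ x, √(maxNorm f N x) ∂(haar m) := by
  have hdep : ∀ n, DependsOn (f n) (Set.Iio n) := fun n => dependsOn_of_stronglyMeasurable (hf.1 n)
  have hsdep : DependsOn (fun x => √(maxNorm f N x)) (Set.Iio N) := fun x y hxy => by
    simp only [dependsOn_maxNorm hdep hxy]
  have hI : 0 ≤ ∫ x, √(maxNorm f N x) ∂(haar m) := integral_nonneg fun _ => Real.sqrt_nonneg _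
  have hC : 0 < atomConst b := by
    have : 0 < b := by have := hm 0; have := hb 0; omega
    unfold atomConst
    positivity
  by_cases h0 : ∀ x, ‖f 0 x‖ ≤ L
  · obtain ⟨K, hK⟩ := exists_norm_le_mul_four_pow hdep N hL
    have hsub : {x | ∃ n : ℕ, n * ((atomConst b + 1) * L) <
        ‖∫ t, f N t * fejer m n (x - t) ∂(haar m)‖} ⊆
        {x | L ≤ ∑ i ∈ levelIntervals f N L K,
          atomConst b * (5 * L * 4 ^ i.1) / (M m i.2.1 : ℝ) ^ 2 *
            majorant m i.2.1 (x - i.2.2)} := by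
      rintro x ⟨n, hn⟩
      have h1 := hn.trans_le (norm_integral_martingale_mul_fejer_le hm hb hf hL h0 hK n x)
      have h2 := lt_of_mul_lt_mul_left h1 (Nat.cast_nonneg n)
      rw [Set.mem_ofPred_eq]
      linarith
    have hMpos : ∀ j, (0 : ℝ) < M m j := fun j => by exact_mod_cast M_pos j
    have h1 := haar_le_sum_majorant hm hb (levelIntervals f N L K) (fun i => i.2.1)
      (fun i => i.2.2) (fun i => atomConst b * (5 * L * 4 ^ i.1) / (M m i.2.1 : ℝ) ^ 2)
      (fun i _ => by have := hMpos i.2.1; positivity) hL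
    -- The square root turns `4 ^ k / M_j ^ 2` into `2 ^ k / M_j`, the quantity that the measures of
    -- the stopping intervals control.
    have hsq : ∀ i : Σ _ : ℕ, Σ _ : ℕ, G m,
        √(atomConst b * (5 * L * 4 ^ i.1) / (M m i.2.1 : ℝ) ^ 2 * L) =
          √(5 * atomConst b) * L * (2 ^ i.1 * (M m i.2.1 : ℝ)⁻¹) := by
      intro i
      have := hMpos i.2.1
      rw [Real.sqrt_eq_iff_mul_self_eq (by positivity) (by positivity)]
      have h5 : √(5 * atomConst b) * √(5 * atomConst b) = 5 * atomConst b :=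
        Real.mul_self_sqrt (by positivity)
      have h4 : (4 : ℝ) ^ i.1 = 2 ^ i.1 * 2 ^ i.1 := by rw [← mul_pow]; norm_num
      rw [h4]
      linear_combination (-(L ^ 2 * (2 ^ i.1) ^ 2 * ((M m i.2.1 : ℝ)⁻¹) ^ 2)) * h5
    have h2 : ∑ i ∈ levelIntervals f N L K,
        12 * b * √(atomConst b * (5 * L * 4 ^ i.1) / (M m i.2.1 : ℝ) ^ 2 * L) ≤
        L * (12 * b ^ 2 * √(5 * atomConst b) *
          ∑ k ∈ Finset.range K, 2 ^ k * (haar m).real {x | L * 4 ^ k < maxNorm f N x}) := by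
      simp only [hsq]
      rw [levelIntervals, Finset.sum_sigma, Finset.mul_sum, Finset.mul_sum]
      refine Finset.sum_le_sum fun k _ => ?_
      have h3 := sum_stopIntervals_le (N := N) (θ := L * 4 ^ k) hb hdep
      calc ∑ p ∈ stopIntervals f N (L * 4 ^ k),
            12 * b * (√(5 * atomConst b) * L * (2 ^ k * (M m p.1 : ℝ)⁻¹))
          = 12 * b * √(5 * atomConst b) * L * 2 ^ k *
            ∑ p ∈ stopIntervals f N (L * 4 ^ k), (M m p.1 : ℝ)⁻¹ := by
            rw [Finset.mul_sum]
            exact Finset.sum_congr rfl fun p _ => by ring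
        _ ≤ 12 * b * √(5 * atomConst b) * L * 2 ^ k *
            (b * (haar m).real {x | L * 4 ^ k < maxNorm f N x}) :=
            mul_le_mul_of_nonneg_left h3 (by positivity)
        _ = _ := by ring
    have h3 := le_of_mul_le_mul_left (h1.trans h2) hL
    have h4 := sum_two_pow_mul_haar_le (N := N) hdep hL K
    calc _ ≤ √L * (haar m).real {x | L ≤ ∑ i ∈ levelIntervals f N L K,
          atomConst b * (5 * L * 4 ^ i.1) / (M m i.2.1 : ℝ) ^ 2 *
            majorant m i.2.1 (x - i.2.2)} :=
          mul_le_mul_of_nonneg_left (measureReal_mono hsub) (Real.sqrt_nonneg _)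
      _ ≤ √L * (12 * b ^ 2 * √(5 * atomConst b) *
          ∑ k ∈ Finset.range K, 2 ^ k * (haar m).real {x | L * 4 ^ k < maxNorm f N x}) :=
          mul_le_mul_of_nonneg_left h3 (Real.sqrt_nonneg _)
      _ = 12 * b ^ 2 * √(5 * atomConst b) * (√L * ∑ k ∈ Finset.range K,
          2 ^ k * (haar m).real {x | L * 4 ^ k < maxNorm f N x}) := by ring
      _ ≤ 12 * b ^ 2 * √(5 * atomConst b) * (2 * ∫ x, √(maxNorm f N x) ∂(haar m)) :=
          mul_le_mul_of_nonneg_left h4 (by positivity)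
      _ ≤ weakConst b * ∫ x, √(maxNorm f N x) ∂(haar m) := by
          rw [weakConst]
          linarith
  -- Here the constant `f 0` exceeds `L` in norm, so the maximal function does so everywhere and the
  -- trivial bound on the measure suffices. This is the reason for the summand `1` in `weakConst`.
  · push Not at h0
    obtain ⟨z, hz⟩ := h0
    have hle : ∀ x, √L ≤ √(maxNorm f N x) := by
      intro x
      refine Real.sqrt_le_sqrt (le_trans ?_ (norm_le_maxNorm (Nat.zero_le N) x))
      rw [hdep 0 (x := x) (y := z) fun i hi => absurd hi (Nat.not_lt_zero i)]
      exact hz.le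
    have h1 : √L ≤ ∫ x, √(maxNorm f N x) ∂(haar m) := by
      have := integral_mono (integrable_const (√L)) hsdep.integrable hle
      simpa using this
    have hw : 1 ≤ weakConst b := by
      have : 0 ≤ 24 * (b : ℝ) ^ 2 * √(5 * atomConst b) := by positivity
      rw [weakConst]
      linarith
    calc _ ≤ √L * 1 := mul_le_mul_of_nonneg_left measureReal_le_one (Real.sqrt_nonneg _)
      _ ≤ ∫ x, √(maxNorm f N x) ∂(haar m) := by rw [mul_one]; exact h1
      _ ≤ _ := le_mul_of_one_le_left hI hw

end WeakType

/-! ### From Fejér means to the maximal operator of the `T` means. -/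

section MaximalOperator

variable {m : ℕ → ℕ} {f : ℕ → G m → ℂ}

/-- Integration against a function of the first `N` coordinates. -/
theorem integral_mul_eq_sum_reps [∀ k, NeZero (m k)] {N : ℕ} {g h : G m → ℂ}
    (hg : DependsOn g (Set.Iio N)) (hh : Integrable h (haar m)) :
    ∫ x, h x * g x ∂(haar m) =
      ∑ y ∈ reps m N, (∫ x in interval m N y, h x ∂(haar m)) * g y := by
  have hpt : ∀ x, h x * g x = ∑ y ∈ reps m N, (interval m N y).indicator h x * g y := by
    intro x
    rw [Finset.sum_eq_single (trunc N x)]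
    · rw [Set.indicator_of_mem ((mem_interval_iff_trunc_eq (trunc_mem_reps N x)).2 rfl),
        ← hg.eq_trunc x]
    · intro y hy hne
      rw [Set.indicator_of_notMem, zero_mul]
      exact fun hx => hne ((mem_interval_iff_trunc_eq hy).1 hx).symm
    · exact fun hn => absurd (trunc_mem_reps N x) hn
  simp only [hpt]
  rw [integral_finsetSum _ fun y _ =>
    (hh.indicator (measurableSet_interval m N y)).mul_const (g y)]
  refine Finset.sum_congr rfl fun y _ => ?_
  rw [integral_mul_const, integral_indicator (measurableSet_interval m N y)]

theorem integral_martingale_mul_eq [∀ k, NeZero (m k)]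
    (hf : Martingale f (filtration m) (haar m)) {N k : ℕ} (hk : N ≤ k) {g : G m → ℂ}
    (hg : DependsOn g (Set.Iio N)) :
    ∫ x, f k x * g x ∂(haar m) = ∫ x, f N x * g x ∂(haar m) := by
  rw [integral_mul_eq_sum_reps hg (hf.integrable k), integral_mul_eq_sum_reps hg (hf.integrable N)]
  refine Finset.sum_congr rfl fun y _ => ?_
  rw [hf.setIntegral_eq hk (measurableSet_interval_filtration N y)]

theorem dependsOn_conj_psi (hm : ∀ k, 2 ≤ m k) {n A : ℕ} (h : n < M m A) :
    DependsOn (fun x => (starRingEnd ℂ) (psi m n x)) (Set.Iio A) := fun x y hxy => by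
  simp only [dependsOn_psi hm h hxy]

theorem coeff_eq_integral [∀ k, NeZero (m k)] (hm : ∀ k, 2 ≤ m k)
    (hf : Martingale f (filtration m) (haar m)) {N i : ℕ} (hi : i < M m N) :
    coeff m f i = ∫ x, f N x * (starRingEnd ℂ) (psi m i x) ∂(haar m) := by
  refine Tendsto.limUnder_eq (tendsto_const_nhds.congr' ?_)
  filter_upwards [eventually_ge_atTop N] with k hk
  exact (integral_martingale_mul_eq hf hk (dependsOn_conj_psi hm hi)).symm

/-- All frequencies involved are below `M_N`, so the coefficients of `f` are those of the single
function `f N`, and the sum is a convolution with the Fejér kernel. -/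
theorem sum_partialSum_eq_integral [∀ k, NeZero (m k)] (hm : ∀ k, 2 ≤ m k)
    (hf : Martingale f (filtration m) (haar m)) {N n : ℕ} (hn : n ≤ M m N) (x : G m) :
    ∑ j ∈ Finset.range n, partialSum m f j x =
      ∫ t, f N t * fejer m n (x - t) ∂(haar m) := by
  have hdep : DependsOn (f N) (Set.Iio N) := dependsOn_of_stronglyMeasurable (hf.1 N)
  have hint : ∀ i < M m N, Integrable (fun t => psi m i x * (f N t *
      (starRingEnd ℂ) (psi m i t))) (haar m) := fun i hi => by
    refine Integrable.const_mul (DependsOn.integrable (n := N) fun t u htu => ?_) _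
    simp only [hdep htu, dependsOn_psi hm hi htu]
  have hlt : ∀ j ∈ Finset.range n, ∀ i ∈ Finset.range j, i < M m N := fun j hj i hi => by
    simp only [Finset.mem_range] at hi hj
    omega
  have h1 : ∀ t, f N t * fejer m n (x - t) = ∑ j ∈ Finset.range n, ∑ i ∈ Finset.range j,
      psi m i x * (f N t * (starRingEnd ℂ) (psi m i t)) := by
    intro t
    simp only [fejer, dirichlet, Finset.mul_sum, psi_sub]
    exact Finset.sum_congr rfl fun j _ => Finset.sum_congr rfl fun i _ => by ring
  simp only [h1]
  rw [integral_finsetSum _ fun j hj => integrable_finsetSum _ fun i hi => hint i (hlt j hj i hi)]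
  refine Finset.sum_congr rfl fun j hj => ?_
  rw [integral_finsetSum _ fun i hi => hint i (hlt j hj i hi), partialSum]
  refine Finset.sum_congr rfl fun i hi => ?_
  rw [integral_const_mul, coeff_eq_integral hm hf (hlt j hj i hi), mul_comm]

/-- Abel summation: weighted means with non-increasing weights are dominated by the
arithmetic means. -/
theorem norm_sum_smul_le_of_antitone {q : ℕ → ℝ} (hq0 : ∀ k, 0 ≤ q k) (hq : Antitone q)
    {S : ℕ → ℂ} {L : ℝ} {n : ℕ}
    (h : ∀ k ≤ n, ‖∑ j ∈ Finset.range k, S j‖ ≤ k * L) :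
    ‖∑ k ∈ Finset.range n, (q k : ℂ) * S k‖ ≤ Q q n * L := by
  -- `Q q k - k * q k` is the sum of `(j + 1) * (q j - q (j + 1))` over `j < k`, the total weight
  -- that Abel summation gives to the earlier arithmetic means.
  have key : ∀ k ≤ n, ‖∑ j ∈ Finset.range k, (q j : ℂ) * S j -
      q k * ∑ j ∈ Finset.range k, S j‖ ≤ (Q q k - k * q k) * L := by
    intro k hk
    induction k with
    | zero => simp [Q]
    | succ k ih =>
      have h1 := ih (by omega)
      have h2 := h (k + 1) hk
      have h3 : ∑ j ∈ Finset.range (k + 1), (q j : ℂ) * S j -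
          q (k + 1) * ∑ j ∈ Finset.range (k + 1), S j =
          (∑ j ∈ Finset.range k, (q j : ℂ) * S j - q k * ∑ j ∈ Finset.range k, S j) +
            ((q k - q (k + 1) : ℝ) : ℂ) * ∑ j ∈ Finset.range (k + 1), S j := by
        simp only [Finset.sum_range_succ]
        push_cast
        ring
      have h4 : 0 ≤ q k - q (k + 1) := sub_nonneg.2 (hq k.le_succ)
      rw [h3]
      refine (norm_add_le _ _).trans ?_
      rw [norm_mul, Complex.norm_real, Real.norm_of_nonneg h4]
      have h5 := mul_le_mul_of_nonneg_left h2 h4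
      have h6 : Q q (k + 1) = Q q k + q k := Finset.sum_range_succ _ _
      rw [h6]
      push_cast at h5 ⊢
      linarith
  have h1 := key n le_rfl
  have h2 := mul_le_mul_of_nonneg_left (h n le_rfl) (hq0 n)
  have h3 : ‖(q n : ℂ) * ∑ j ∈ Finset.range n, S j‖ = q n * ‖∑ j ∈ Finset.range n, S j‖ := by
    rw [norm_mul, Complex.norm_real, Real.norm_of_nonneg (hq0 n)]
  have h4 := norm_add_le (∑ j ∈ Finset.range n, (q j : ℂ) * S j -
      q n * ∑ j ∈ Finset.range n, S j) ((q n : ℂ) * ∑ j ∈ Finset.range n, S j)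
  rw [sub_add_cancel] at h4
  linarith

theorem Q_pos {q : ℕ → ℝ} (hq0 : ∀ k, 0 ≤ q k) (hq : 0 < q 0) {n : ℕ} (hn : n ≠ 0) :
    0 < Q q n :=
  hq.trans_le (Finset.single_le_sum (f := q) (fun k _ => hq0 k)
    (Finset.mem_range.2 (Nat.pos_of_ne_zero hn)))

theorem norm_tMean_le {q : ℕ → ℝ} (hq0 : ∀ k, 0 ≤ q k) (hqpos : 0 < q 0) (hq : Antitone q)
    {L : ℝ} (hL : 0 ≤ L) {n : ℕ} {x : G m}
    (h : ∀ k ≤ n, ‖∑ j ∈ Finset.range k, partialSum m f j x‖ ≤ k * L) :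
    ‖tMean m q f n x‖ ≤ L := by
  rcases eq_or_ne n 0 with rfl | hn
  · simpa [tMean] using hL
  · have hQ := Q_pos hq0 hqpos hn
    rw [tMean, norm_mul, norm_div, norm_one, Complex.norm_real, Real.norm_of_nonneg hQ.le,
      one_div, inv_mul_le_iff₀ hQ]
    exact norm_sum_smul_le_of_antitone hq0 hq h

theorem ofReal_integral_sqrt_maxNorm_le [∀ k, NeZero (m k)]
    (hf : ∀ n, DependsOn (f n) (Set.Iio n)) (N : ℕ) :
    ENNReal.ofReal (∫ x, √(maxNorm f N x) ∂(haar m)) ≤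
      ∫⁻ x, (⨆ n, ‖f n x‖ₑ) ^ (1 / 2 : ℝ) ∂(haar m) := by
  have hdep : DependsOn (fun x => √(maxNorm f N x)) (Set.Iio N) := fun x y hxy => by
    simp only [dependsOn_maxNorm hf hxy]
  rw [ofReal_integral_eq_lintegral_ofReal hdep.integrable
    (ae_of_all _ fun _ => Real.sqrt_nonneg _)]
  refine lintegral_mono fun x => ?_
  rw [Real.sqrt_eq_rpow, ← ENNReal.ofReal_rpow_of_nonneg (NNReal.coe_nonneg _) (by norm_num),
    ENNReal.ofReal_coe_nnreal]
  refine ENNReal.rpow_le_rpow ?_ (by norm_num)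
  obtain ⟨n, _, hn⟩ := Finset.exists_mem_eq_sup (Finset.range (N + 1)) ⟨0, by simp⟩
    fun n => ‖f n x‖₊
  rw [maxNorm, hn]
  exact le_iSup (fun n => ‖f n x‖ₑ) n

/-- The maximal operator of the `T` means is bounded from `H_{1/2}` to weak `L_{1/2}`. -/
theorem exists_weakNorm_tMax_le (hm : ∀ k, 2 ≤ m k) (hm_bdd : BddAbove (Set.range m))
    {q : ℕ → ℝ} (hq0 : ∀ k, 0 ≤ q k) (hqpos : 0 < q 0) (hq : Antitone q) :
    ∃ C : ℝ≥0, ∀ f : ℕ → G m → ℂ, MemHardy m (1 / 2) f →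
      weakNorm m (1 / 2) (tMax m q f) ≤ (C : ℝ≥0∞) * hardyNorm m (1 / 2) f := by
  have : ∀ k, NeZero (m k) := fun k => ⟨by have := hm k; omega⟩
  obtain ⟨b, hb'⟩ := hm_bdd
  have hb : ∀ k, m k ≤ b := fun k => hb' ⟨k, rfl⟩
  have hC : 0 < atomConst b + 1 := by unfold atomConst; positivity
  have hW : 0 ≤ weakConst b := by unfold weakConst; positivity
  refine ⟨(√(atomConst b + 1) * weakConst b).toNNReal ^ 2, fun f hf => ?_⟩
  have hdep : ∀ n, DependsOn (f n) (Set.Iio n) := fun n =>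
    dependsOn_of_stronglyMeasurable (hf.1.1 n)
  have hhardy : hardyNorm m (1 / 2) f =
      (∫⁻ x, (⨆ n, ‖f n x‖ₑ) ^ (1 / 2 : ℝ) ∂(haar m)) ^ (2 : ℝ) := by
    rw [hardyNorm, eLpNorm_eq_lintegral_rpow_enorm_toReal (by norm_num) ENNReal.ofReal_ne_top,
      ENNReal.toReal_ofReal (by norm_num)]
    simp
  have hmain : ∀ t : {t : ℝ≥0 // 0 < t}, ((t : ℝ≥0) : ℝ≥0∞) ^ (1 / 2 : ℝ) *
      haar m {x | ((t : ℝ≥0) : ℝ≥0∞) < ‖tMax m q f x‖ₑ} ≤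
      ENNReal.ofReal (√(atomConst b + 1) * weakConst b) *
        ∫⁻ x, (⨆ n, ‖f n x‖ₑ) ^ (1 / 2 : ℝ) ∂(haar m) := by
    rintro ⟨t, ht⟩
    have ht' : (0 : ℝ) < t := by exact_mod_cast ht
    simp only
    -- Means of order at most `M_N` depend only on `f N`. The estimate is uniform in `N`, and
    -- continuity from below of the measure passes it to the supremum over all orders.
    let E : ℕ → Set (G m) := fun N => {x | ∃ n ≤ M m N, (t : ℝ) < ‖tMean m q f n x‖}
    have hE : Monotone E := fun N N' h x ⟨n, hn, hx⟩ => ⟨n, hn.trans (M_mono hm h), hx⟩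
    have hset : {x | (t : ℝ≥0∞) < ‖tMax m q f x‖ₑ} = ⋃ N, E N := by
      ext x
      simp only [enorm_eq_self, tMax, Set.mem_ofPred_eq, lt_iSup_iff, Set.mem_iUnion, E]
      have hn : ∀ n, (t : ℝ≥0∞) < ‖tMean m q f n x‖ₑ ↔ (t : ℝ) < ‖tMean m q f n x‖ := by
        intro n
        rw [← ofReal_norm, ← ENNReal.ofReal_coe_nnreal, ENNReal.ofReal_lt_ofReal_iff']
        exact ⟨fun h => h.1, fun h => ⟨h, ht'.trans h⟩⟩
      simp only [hn]
      exact ⟨fun ⟨n, h⟩ => ⟨n, n, (lt_M hm n).le, h⟩, fun ⟨_, n, _, h⟩ => ⟨n, h⟩⟩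
    rw [hset, hE.measure_iUnion, ENNReal.mul_iSup]
    refine iSup_le fun N => ?_
    set L : ℝ := t / (atomConst b + 1)
    have hL : 0 < L := div_pos ht' hC
    have htL : (t : ℝ) = (atomConst b + 1) * L := by
      simp only [L]
      field_simp
    have hsub : E N ⊆ {x | ∃ n : ℕ, n * ((atomConst b + 1) * L) <
        ‖∫ s, f N s * fejer m n (x - s) ∂(haar m)‖} := by
      rintro x ⟨n, hn, hx⟩
      by_contra hcon
      simp only [Set.mem_ofPred_eq, not_exists, not_lt, ← htL] at hcon
      refine absurd (norm_tMean_le hq0 hqpos hq ht'.le (f := f) fun k hk => ?_) (not_le.2 hx)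
      rw [sum_partialSum_eq_integral hm hf.1 (hk.trans hn)]
      exact hcon k
    have h1 := (mul_le_mul_of_nonneg_left (measureReal_mono (μ := haar m) hsub)
      (Real.sqrt_nonneg L)).trans (sqrt_mul_haar_fejer_gt_le hm hb hf.1 N hL)
    have h2 : (t : ℝ≥0∞) ^ (1 / 2 : ℝ) * haar m (E N) =
        ENNReal.ofReal (√(atomConst b + 1) * (√L * (haar m).real (E N))) := by
      rw [← mul_assoc, ← Real.sqrt_mul hC.le, ← htL, ENNReal.ofReal_mul (Real.sqrt_nonneg _),
        Real.sqrt_eq_rpow, ← ENNReal.ofReal_rpow_of_nonneg ht'.le (by norm_num),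
        ENNReal.ofReal_coe_nnreal, ofReal_measureReal]
    rw [h2]
    calc ENNReal.ofReal (√(atomConst b + 1) * (√L * (haar m).real (E N)))
        ≤ ENNReal.ofReal (√(atomConst b + 1) * (weakConst b *
          ∫ x, √(maxNorm f N x) ∂(haar m))) :=
          ENNReal.ofReal_le_ofReal (mul_le_mul_of_nonneg_left h1 (Real.sqrt_nonneg _))
      _ = ENNReal.ofReal (√(atomConst b + 1) * weakConst b) *
          ENNReal.ofReal (∫ x, √(maxNorm f N x) ∂(haar m)) := by
          rw [← ENNReal.ofReal_mul (by positivity), mul_assoc]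
      _ ≤ _ := mul_le_mul_right (ofReal_integral_sqrt_maxNorm_le hdep N) _
  rw [weakNorm, hhardy]
  refine (ENNReal.rpow_le_rpow (iSup_le hmain) (by norm_num)).trans (le_of_eq ?_)
  rw [ENNReal.mul_rpow_of_nonneg _ _ (by norm_num)]
  norm_num [ENNReal.ofReal]

end MaximalOperator

/-! ### Block martingales: coefficients, Hardy norm, and lower bounds for means. -/

section Divergence

variable {m : ℕ → ℕ}

/-- Translation by the unit vector at the leading digit's position `A ≥ n` preserves the interval
and the measure, but multiplies the character by a root of unity other than `1`. -/
theorem setIntegral_conj_psi_eq_zero [∀ k, NeZero (m k)] (hm : ∀ k, 2 ≤ m k) {n i : ℕ}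
    (hi : M m n ≤ i) : ∫ x in interval m n 0, (starRingEnd ℂ) (psi m i x) ∂(haar m) = 0 := by
  obtain ⟨A, hA1, hA2⟩ := exists_M_le_lt hm ((M_pos n).trans_le hi : 1 ≤ i)
  have hnA : n ≤ A := by
    by_contra h
    have := M_mono hm (by omega : A + 1 ≤ n)
    omega
  have hpos : 0 < M m A := M_pos A
  have ha : i / M m A < m A := (Nat.div_lt_iff_lt_mul hpos).2 hA2
  have ha0 : 0 < i / M m A := Nat.div_pos hA1 hpos
  have hj : i % M m A < M m A := Nat.mod_lt _ hpos
  have hdec : i / M m A * M m A + i % M m A = i := Nat.div_add_mod' i _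
  set a := i / M m A
  set j := i % M m A
  let z : G m := Pi.single A 1
  have hz : ∀ k, k ≠ A → z k = 0 := fun k hk => Pi.single_eq_of_ne hk _
  let ω : ℂ := ZMod.stdAddChar (1 : ZMod (m A))
  have hω : ω ^ a ≠ 1 := by
    have h1 : ω ^ a = ZMod.stdAddChar ((a : ℕ) : ZMod (m A)) := by
      simp only [ω]
      rw [← AddChar.map_nsmul_eq_pow, nsmul_one]
    rw [h1]
    intro h
    have h2 : ((a : ℕ) : ZMod (m A)) = 0 :=
      ZMod.injective_stdAddChar (h.trans (AddChar.map_zero_eq_one _).symm)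
    rw [ZMod.natCast_eq_zero_iff] at h2
    exact absurd (Nat.le_of_dvd ha0 h2) (by omega)
  have hpsi : ∀ x, psi m i (x + z) = ω ^ a * psi m i x := by
    intro x
    rw [← hdec, psi_mul_M_add hm ha hj, psi_mul_M_add hm ha hj]
    have h1 : psi m j (x + z) = psi m j x := dependsOn_psi hm hj fun k hk => by
      rw [Pi.add_apply, hz k (ne_of_lt hk), add_zero]
    have h2 : rademacher m A (x + z) = ω * rademacher m A x := by
      rw [rademacher_eq_stdAddChar, rademacher_eq_stdAddChar, Pi.add_apply, AddChar.map_add_eq_mul,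
        mul_comm]
      simp [z, ω]
    rw [h1, h2]
    ring
  let g : G m → ℂ := (interval m n 0).indicator fun x => (starRingEnd ℂ) (psi m i x)
  have hg : DependsOn g (Set.Iio (A + 1)) :=
    dependsOn_indicator_interval (by omega) 0 (dependsOn_conj_psi hm hA2)
  have hgz : ∀ x, g (x + z) = (starRingEnd ℂ) (ω ^ a) * g x := by
    intro x
    have hmem : x + z ∈ interval m n 0 ↔ x ∈ interval m n 0 :=
      forall₂_congr fun k hk => by rw [Pi.add_apply, hz k (by omega), add_zero]
    by_cases hx : x ∈ interval m n 0
    · simp only [g, Set.indicator_of_mem hx, Set.indicator_of_mem (hmem.2 hx), hpsi, map_mul]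
    · simp only [g, Set.indicator_of_notMem hx, Set.indicator_of_notMem (mt hmem.1 hx), mul_zero]
  have hmp := measurePreserving_add_right z
  have h1 : ∫ x, g x ∂(haar m) = (starRingEnd ℂ) (ω ^ a) * ∫ x, g x ∂(haar m) := by
    rw [← integral_const_mul]
    simp only [← hgz]
    rw [← integral_map (φ := fun x => x + z) hmp.measurable.aemeasurable, hmp.map_eq]
    rw [hmp.map_eq]
    exact hg.integrable.aestronglyMeasurable
  rw [← integral_indicator (measurableSet_interval m n 0)]
  change ∫ x, g x ∂(haar m) = 0
  by_contra hne
  have h2 : (starRingEnd ℂ) (ω ^ a) = 1 := by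
    have h3 : (1 : ℂ) * ∫ x, g x ∂(haar m) = (starRingEnd ℂ) (ω ^ a) * ∫ x, g x ∂(haar m) := by
      rw [one_mul]; exact h1
    exact (mul_right_cancel₀ hne h3).symm
  apply hω
  rw [← Complex.conj_conj (ω ^ a), h2, map_one]

theorem setIntegral_conj_psi_of_lt [∀ k, NeZero (m k)] (hm : ∀ k, 2 ≤ m k) {n i : ℕ}
    (hi : i < M m n) :
    ∫ x in interval m n 0, (starRingEnd ℂ) (psi m i x) ∂(haar m) = (M m n : ℂ)⁻¹ := by
  have h0 : psi m i 0 = 1 := by simp [psi, rademacher]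
  have h : ∀ x ∈ interval m n 0, (starRingEnd ℂ) (psi m i x) = 1 := fun x hx => by
    rw [dependsOn_psi hm hi (y := 0) hx, h0, map_one]
  rw [setIntegral_congr_fun (measurableSet_interval m n 0) h]
  simp [haar_interval]

theorem integral_dirichlet_M_mul_conj_psi [∀ k, NeZero (m k)] (hm : ∀ k, 2 ≤ m k) (n i : ℕ) :
    ∫ x, dirichlet m (M m n) x * (starRingEnd ℂ) (psi m i x) ∂(haar m) =
      if i < M m n then 1 else 0 := by
  have h : ∀ x, dirichlet m (M m n) x * (starRingEnd ℂ) (psi m i x) =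
      (M m n : ℂ) * (interval m n 0).indicator (fun x => (starRingEnd ℂ) (psi m i x)) x := by
    intro x
    rw [dirichlet_M hm]
    by_cases hx : x ∈ interval m n 0 <;> simp [hx]
  simp only [h]
  rw [integral_const_mul, integral_indicator (measurableSet_interval m n 0)]
  split_ifs with hi
  · rw [setIntegral_conj_psi_of_lt hm hi, mul_inv_cancel₀]
    exact_mod_cast (M_pos n).ne'
  · rw [setIntegral_conj_psi_eq_zero hm (not_lt.1 hi), mul_zero]

/-- The martingale whose coefficients equal `β n` on the block `[M_n, M_{n+1})`. -/
def blockMartingale (m : ℕ → ℕ) (β : ℕ → ℝ) (n : ℕ) (x : G m) : ℂ :=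
  ∑ i ∈ Finset.range n, (β i : ℂ) * (dirichlet m (M m (i + 1)) x - dirichlet m (M m i) x)

theorem dependsOn_blockMartingale (hm : ∀ k, 2 ≤ m k) (β : ℕ → ℝ) (n : ℕ) :
    DependsOn (blockMartingale m β n) (Set.Iio n) := by
  intro x y hxy
  refine Finset.sum_congr rfl fun i hi => ?_
  have hi' : i < n := by simpa using hi
  rw [dependsOn_dirichlet hm (M_mono hm (by omega : i + 1 ≤ n)) hxy,
    dependsOn_dirichlet hm (M_mono hm hi'.le) hxy]

/-- On `F_n` every such kernel acts as the point mass at `0`. Hence differences of two of them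
integrate to zero, which makes `blockMartingale` a martingale. -/
theorem setIntegral_dirichlet_M [∀ k, NeZero (m k)] (hm : ∀ k, 2 ≤ m k) {n j : ℕ} (hj : n ≤ j)
    {s : Set (G m)} (hs : MeasurableSet[filtration m n] s) [Decidable ((0 : G m) ∈ s)] :
    ∫ x in s, dirichlet m (M m j) x ∂(haar m) = if (0 : G m) ∈ s then 1 else 0 := by
  have hint : s ∩ interval m j 0 = if (0 : G m) ∈ s then interval m j 0 else ∅ := by
    have h1 : ∀ x ∈ interval m j 0, (x ∈ s ↔ (0 : G m) ∈ s) := fun x hx =>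
      mem_of_measurableSet_filtration hs fun i hi => hx i (by omega)
    split_ifs with h
    · exact Set.inter_eq_right.2 fun x hx => (h1 x hx).2 h
    · rw [Set.eq_empty_iff_forall_notMem]
      rintro x ⟨hxs, hx⟩
      exact h ((h1 x hx).1 hxs)
  simp only [dirichlet_M hm]
  rw [setIntegral_indicator (measurableSet_interval m j 0), hint]
  split_ifs
  · have : (M m j : ℂ) ≠ 0 := by exact_mod_cast (M_pos j).ne'
    simp [haar_interval, this]
  · simp

theorem integrable_dirichlet [∀ k, NeZero (m k)] (hm : ∀ k, 2 ≤ m k) (n : ℕ) :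
    Integrable (dirichlet m n) (haar m) :=
  (dependsOn_dirichlet hm (lt_M hm n).le).integrable

theorem martingale_blockMartingale [∀ k, NeZero (m k)] (hm : ∀ k, 2 ≤ m k) (β : ℕ → ℝ) :
    Martingale (blockMartingale m β) (filtration m) (haar m) := by
  classical
  have hdep := dependsOn_blockMartingale hm β
  refine martingale_nat (fun n => (hdep n).stronglyMeasurable) (fun n => (hdep n).integrable)
    fun n => ?_
  refine ae_eq_condExp_of_forall_setIntegral_eq ((filtration m).le n) (hdep (n + 1)).integrable
    (fun s _ _ => (hdep n).integrable.integrableOn) (fun s hs _ => ?_)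
    (hdep n).stronglyMeasurable.aestronglyMeasurable
  have h1 : ∀ x, blockMartingale m β (n + 1) x = blockMartingale m β n x +
      (β n : ℂ) * (dirichlet m (M m (n + 1)) x - dirichlet m (M m n) x) := fun x =>
    Finset.sum_range_succ _ _
  simp only [h1]
  have hi : ∀ k, Integrable (dirichlet m k) ((haar m).restrict s) := fun k =>
    (integrable_dirichlet hm k).integrableOn
  have hd : Integrable (fun x => (β n : ℂ) *
      (dirichlet m (M m (n + 1)) x - dirichlet m (M m n) x)) ((haar m).restrict s) :=
    ((hi _).sub (hi _)).const_mul _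
  rw [integral_add (hdep n).integrable.integrableOn hd,
    integral_const_mul, integral_sub (hi _) (hi _), setIntegral_dirichlet_M hm n.le_succ hs,
    setIntegral_dirichlet_M hm le_rfl hs, sub_self, mul_zero, add_zero]

theorem coeff_blockMartingale [∀ k, NeZero (m k)] (hm : ∀ k, 2 ≤ m k) (β : ℕ → ℝ) {n i : ℕ}
    (h1 : M m n ≤ i) (h2 : i < M m (n + 1)) : coeff m (blockMartingale m β) i = β n := by
  rw [coeff_eq_integral hm (martingale_blockMartingale hm β) h2]
  have hdep : ∀ k, DependsOn (dirichlet m k) (Set.Iio k) := fun k =>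
    dependsOn_dirichlet hm (lt_M hm k).le
  have hi : ∀ k, Integrable (fun x => dirichlet m k x * (starRingEnd ℂ) (psi m i x)) (haar m) := by
    intro k
    refine DependsOn.integrable (n := max k (n + 1)) fun x y hxy => ?_
    have e1 := hdep k (x := x) (y := y) fun j hj =>
      hxy j (Set.mem_Iio.2 (lt_of_lt_of_le (Set.mem_Iio.1 hj) (le_max_left _ _)))
    have e2 := dependsOn_psi hm h2 (x := x) (y := y) fun j hj =>
      hxy j (Set.mem_Iio.2 (lt_of_lt_of_le (Set.mem_Iio.1 hj) (le_max_right _ _)))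
    simp only [e1, e2]
  simp only [blockMartingale, Finset.sum_mul, mul_assoc, sub_mul]
  have hd : ∀ k, Integrable (fun x => (β k : ℂ) *
      (dirichlet m (M m (k + 1)) x * (starRingEnd ℂ) (psi m i x) -
        dirichlet m (M m k) x * (starRingEnd ℂ) (psi m i x))) (haar m) := fun k =>
    ((hi _).sub (hi _)).const_mul _
  rw [integral_finsetSum _ fun k _ => hd k]
  simp only [integral_const_mul]
  rw [Finset.sum_range_succ, Finset.sum_eq_zero, integral_sub (hi _) (hi _),
    integral_dirichlet_M_mul_conj_psi hm, integral_dirichlet_M_mul_conj_psi hm, if_pos h2,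
    if_neg (not_lt.2 h1)]
  · simp
  · intro k hk
    have hk' : k + 1 ≤ n := by simpa using hk
    have e1 := (M_mono hm hk').trans h1
    have e2 := (M_mono hm k.le_succ).trans e1
    rw [integral_sub (hi _) (hi _),
      integral_dirichlet_M_mul_conj_psi hm, integral_dirichlet_M_mul_conj_psi hm,
      if_neg (not_lt.2 e1), if_neg (not_lt.2 e2), sub_self, mul_zero]

theorem coeff_blockMartingale_zero [∀ k, NeZero (m k)] (hm : ∀ k, 2 ≤ m k) (β : ℕ → ℝ) :
    coeff m (blockMartingale m β) 0 = 0 := by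
  rw [coeff_eq_integral hm (martingale_blockMartingale hm β) (N := 0) (by simp [M])]
  simp [blockMartingale]

theorem sum_norm_coeff_blockMartingale_le [∀ k, NeZero (m k)] (hm : ∀ k, 2 ≤ m k) {β : ℕ → ℝ}
    (hβ : ∀ n, 0 ≤ β n) (n : ℕ) :
    ∑ i ∈ Finset.range (M m n), ‖coeff m (blockMartingale m β) i‖ ≤
      ∑ k ∈ Finset.range n, β k * M m (k + 1) := by
  induction n with
  | zero => simp [M, coeff_blockMartingale_zero hm]
  | succ n ih =>
    rw [Finset.sum_range_succ, ← Finset.sum_range_add_sum_Ico _ (M_mono hm n.le_succ)]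
    refine add_le_add ih ?_
    have h : ∀ i ∈ Finset.Ico (M m n) (M m (n + 1)), ‖coeff m (blockMartingale m β) i‖ = β n := by
      intro i hi
      rw [Finset.mem_Ico] at hi
      rw [coeff_blockMartingale hm β hi.1 hi.2, Complex.norm_real, Real.norm_of_nonneg (hβ n)]
    rw [Finset.sum_congr rfl h, Finset.sum_const, Nat.card_Ico, nsmul_eq_mul, mul_comm]
    refine mul_le_mul_of_nonneg_left ?_ (hβ n)
    exact_mod_cast Nat.sub_le _ _

theorem norm_partialSum_le [∀ k, NeZero (m k)] (f : ℕ → G m → ℂ) {k n : ℕ} (h : k ≤ n) (x : G m) :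
    ‖partialSum m f k x‖ ≤ ∑ i ∈ Finset.range n, ‖coeff m f i‖ := by
  refine (norm_sum_le _ _).trans ?_
  simp only [norm_mul, norm_psi, mul_one]
  exact Finset.sum_le_sum_of_subset_of_nonneg (Finset.range_mono h) fun _ _ _ => norm_nonneg _

/-- Lower bound of a `T` mean in terms of its last coefficient. -/
theorem le_norm_tMean [∀ k, NeZero (m k)] (f : ℕ → G m → ℂ) {q : ℕ → ℝ} (hq0 : ∀ k, 0 ≤ q k)
    (hqpos : 0 < q 0) (n : ℕ) (x : G m) :
    q (n + 1) / Q q (n + 2) * ‖coeff m f n‖ - ∑ i ∈ Finset.range n, ‖coeff m f i‖ ≤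
      ‖tMean m q f (n + 2) x‖ := by
  set R := ∑ i ∈ Finset.range n, ‖coeff m f i‖
  have hR : 0 ≤ R := Finset.sum_nonneg fun _ _ => norm_nonneg _
  have hQ : 0 < Q q (n + 2) := Q_pos hq0 hqpos (by omega)
  -- The mean of order `n + 2` is the first to contain the coefficient of index `n`, through
  -- `S_{n+1}` alone. Once that term is split off, only coefficients below `n` remain.
  have h1 : ‖∑ k ∈ Finset.range (n + 1), (q k : ℂ) * partialSum m f k x +
      q (n + 1) * partialSum m f n x‖ ≤ Q q (n + 2) * R := by
    have hterm : ∀ k j, j ≤ n → ‖(q k : ℂ) * partialSum m f j x‖ ≤ q k * R := by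
      intro k j hj
      rw [norm_mul, Complex.norm_real, Real.norm_of_nonneg (hq0 k)]
      exact mul_le_mul_of_nonneg_left (norm_partialSum_le f hj x) (hq0 k)
    refine (norm_add_le _ _).trans ?_
    rw [Q, Finset.sum_range_succ q, add_mul, Finset.sum_mul]
    refine add_le_add (norm_sum_le_of_le _ fun k hk => ?_) (hterm _ _ le_rfl)
    exact hterm k k (by simpa [Nat.lt_succ_iff] using hk)
  have h2 : ∑ k ∈ Finset.range (n + 2), (q k : ℂ) * partialSum m f k x =
      (∑ k ∈ Finset.range (n + 1), (q k : ℂ) * partialSum m f k x +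
        q (n + 1) * partialSum m f n x) + q (n + 1) * (coeff m f n * psi m n x) := by
    rw [Finset.sum_range_succ, partialSum, Finset.sum_range_succ (fun k => coeff m f k * psi m k x),
      ← partialSum]
    ring
  have h3 : ‖(q (n + 1) : ℂ) * (coeff m f n * psi m n x)‖ = q (n + 1) * ‖coeff m f n‖ := by
    rw [norm_mul, norm_mul, norm_psi, Complex.norm_real, Real.norm_of_nonneg (hq0 _), mul_one]
  rw [tMean, norm_mul, norm_div, norm_one, Complex.norm_real, Real.norm_of_nonneg hQ.le, h2,
    one_div, ← div_eq_inv_mul, le_div_iff₀ hQ]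
  have h4 := norm_sub_le_norm_add ((q (n + 1) : ℂ) * (coeff m f n * psi m n x))
    (∑ k ∈ Finset.range (n + 1), (q k : ℂ) * partialSum m f k x + q (n + 1) * partialSum m f n x)
  rw [add_comm ((q (n + 1) : ℂ) * (coeff m f n * psi m n x)), h3] at h4
  have h5 : (q (n + 1) / Q q (n + 2) * ‖coeff m f n‖ - R) * Q q (n + 2) =
      q (n + 1) * ‖coeff m f n‖ - Q q (n + 2) * R := by
    field_simp
  rw [h5]
  linarith

theorem le_weakNorm [∀ k, NeZero (m k)] {p : ℝ} (hp : 0 < p) {g : G m → ℂ} {t : ℝ≥0} (ht : 0 < t)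
    (h : ∀ x, (t : ℝ) < ‖g x‖) : (t : ℝ≥0∞) ≤ weakNorm m p g := by
  have hset : {x | ((t : ℝ≥0) : ℝ≥0∞) < ‖g x‖ₑ} = Set.univ := by
    refine Set.eq_univ_of_forall fun x => ?_
    rw [Set.mem_ofPred_eq, ← ofReal_norm, ← ENNReal.ofReal_coe_nnreal]
    exact (ENNReal.ofReal_lt_ofReal_iff_of_nonneg t.coe_nonneg).2 (h x)
  have h1 := le_iSup (fun t : {t : ℝ≥0 // 0 < t} => ((t : ℝ≥0) : ℝ≥0∞) ^ p *
    haar m {x | ((t : ℝ≥0) : ℝ≥0∞) < ‖g x‖ₑ}) ⟨t, ht⟩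
  simp only [hset, measure_univ, mul_one] at h1
  rw [weakNorm]
  calc (t : ℝ≥0∞) = ((t : ℝ≥0∞) ^ p) ^ (1 / p) := by
        rw [← ENNReal.rpow_mul, mul_one_div_cancel hp.ne', ENNReal.rpow_one]
    _ ≤ _ := ENNReal.rpow_le_rpow h1 (by positivity)

theorem rpow_sum_le_sum_rpow {ι : Type*} (s : Finset ι) (g : ι → ℝ≥0∞) {p : ℝ} (hp : 0 < p)
    (hp1 : p ≤ 1) : (∑ i ∈ s, g i) ^ p ≤ ∑ i ∈ s, g i ^ p := by
  classical
  induction s using Finset.induction_on with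
  | empty => simp [hp]
  | insert i s hi ih =>
    rw [Finset.sum_insert hi, Finset.sum_insert hi]
    exact (ENNReal.rpow_add_le_add_rpow _ _ hp.le hp1).trans (by gcongr)

/-- The `n`-th increment lives on an interval of measure `1 / M_n` and has size at most `2 b β_n
M_n`. For `p ≤ 1`, the `p`-th power of the maximal function is at most the sum of the `p`-th powers
of these bounds. -/
theorem hardyNorm_blockMartingale_lt_top [∀ k, NeZero (m k)] (hm : ∀ k, 2 ≤ m k) {b : ℕ}
    (hb : ∀ k, m k ≤ b) {β : ℕ → ℝ} (hβ : ∀ n, 0 ≤ β n) {p : ℝ} (hp : 0 < p) (hp1 : p ≤ 1)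
    (hsum : ∑' n, ENNReal.ofReal ((β n * M m n) ^ p * (M m n : ℝ)⁻¹) < ∞) :
    hardyNorm m p (blockMartingale m β) < ∞ := by
  have hb1 : (1 : ℝ) ≤ b := by exact_mod_cast (by have := hm 0; have := hb 0; omega : 1 ≤ b)
  let g : ℕ → G m → ℝ≥0∞ := fun n => (interval m n 0).indicator
    fun _ => ENNReal.ofReal (2 * b * (β n * M m n))
  have hterm : ∀ n x, ‖(β n : ℂ) * (dirichlet m (M m (n + 1)) x - dirichlet m (M m n) x)‖ₑ ≤
      g n x := by
    intro n x
    have hM : (M m (n + 1) : ℝ) ≤ b * M m n := by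
      rw [M_succ]
      push_cast
      exact mul_le_mul_of_nonneg_right (by exact_mod_cast hb n) (by positivity)
    have hM0 : (0 : ℝ) ≤ M m n := by positivity
    rw [← ofReal_norm, norm_mul, Complex.norm_real, Real.norm_of_nonneg (hβ n)]
    by_cases hx : x ∈ interval m n 0
    · simp only [g, Set.indicator_of_mem hx]
      refine ENNReal.ofReal_le_ofReal ?_
      have h1 : ‖dirichlet m (M m (n + 1)) x - dirichlet m (M m n) x‖ ≤ 2 * b * M m n := by
        refine (norm_sub_le _ _).trans ?_
        rw [norm_dirichlet_M hm, norm_dirichlet_M hm, Set.indicator_of_mem hx]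
        have h2 : (interval m (n + 1) 0).indicator (fun _ => (M m (n + 1) : ℝ)) x ≤
            M m (n + 1) := Set.indicator_le_self' (fun _ _ => by positivity) x
        nlinarith
      calc β n * _ ≤ β n * (2 * b * M m n) := mul_le_mul_of_nonneg_left h1 (hβ n)
        _ = _ := by ring
    · have hx' : x ∉ interval m (n + 1) 0 := fun h => hx fun i hi => h i (by omega)
      simp [dirichlet_M hm, hx, hx']
  have hsup : ∀ x, (⨆ n, ‖blockMartingale m β n x‖ₑ) ^ p ≤ ∑' n, g n x ^ p := by
    intro x
    rw [← ENNReal.le_rpow_inv_iff hp]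
    refine iSup_le fun n => ?_
    rw [ENNReal.le_rpow_inv_iff hp]
    calc ‖blockMartingale m β n x‖ₑ ^ p ≤ (∑ i ∈ Finset.range n, g i x) ^ p := by
          refine ENNReal.rpow_le_rpow ((enorm_sum_le _ _).trans ?_) hp.le
          exact Finset.sum_le_sum fun i _ => hterm i x
      _ ≤ ∑ i ∈ Finset.range n, g i x ^ p := rpow_sum_le_sum_rpow _ _ hp hp1
      _ ≤ ∑' i, g i x ^ p := ENNReal.sum_le_tsum _
  have hint : ∀ n, ∫⁻ x, g n x ^ p ∂(haar m) = ENNReal.ofReal ((2 * b) ^ p) *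
      ENNReal.ofReal ((β n * M m n) ^ p * (M m n : ℝ)⁻¹) := by
    intro n
    have h1 : ∀ x, g n x ^ p = (interval m n 0).indicator
        (fun _ => ENNReal.ofReal (2 * b * (β n * M m n)) ^ p) x := by
      intro x
      by_cases hx : x ∈ interval m n 0 <;> simp [g, hx, hp]
    have hβM : 0 ≤ β n * M m n := mul_nonneg (hβ n) (by positivity)
    have hμ : haar m (interval m n 0) = ENNReal.ofReal (M m n : ℝ)⁻¹ := by
      rw [← haar_interval n 0, ofReal_measureReal]
    simp only [h1]
    rw [lintegral_indicator_const (measurableSet_interval m n 0), hμ,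
      ENNReal.ofReal_rpow_of_nonneg (by positivity) hp.le,
      ← ENNReal.ofReal_mul (by positivity), ← ENNReal.ofReal_mul (by positivity),
      Real.mul_rpow (by positivity) hβM, mul_assoc]
  rw [hardyNorm, eLpNorm_lt_top_iff_lintegral_rpow_enorm_lt_top
    (by simpa using hp) ENNReal.ofReal_ne_top, ENNReal.toReal_ofReal hp.le]
  simp only [enorm_eq_self]
  refine (lintegral_mono hsup).trans_lt ?_
  rw [lintegral_tsum fun n => ?_]
  · simp only [hint]
    rw [ENNReal.tsum_mul_left]
    exact ENNReal.mul_lt_top ENNReal.ofReal_lt_top hsum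
  · exact ((measurable_const.indicator (measurableSet_interval m n 0)).pow_const p).aemeasurable

end Divergence

/-! ### Choice of sparse blocks and the counterexample below `1/2`. -/

section Lacunary

variable {m : ℕ → ℕ}

/-- A lacunary choice of indices for which each term dominates the sum of the previous ones. -/
theorem exists_strictMono_add_sum_le (X Y : ℕ → ℕ → ℝ) (hY : ∀ k, Tendsto (Y k) atTop atTop) :
    ∃ α : ℕ → ℕ, StrictMono α ∧
      ∀ k : ℕ, k + 2 + ∑ l ∈ Finset.range k, X l (α l) ≤ Y k (α k) := by
  have hex : ∀ (k a : ℕ) (r : ℝ), ∃ a' > a, k + 2 + r ≤ Y k a' := fun k a r =>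
    ((eventually_gt_atTop a).and ((hY k).eventually_ge_atTop (k + 2 + r))).exists
  choose next h1 h2 using hex
  -- The state is the current index together with the sum of `X` over all earlier indices, so each
  -- new index can be chosen large against that sum.
  let s : ℕ → ℕ × ℝ := fun k => Nat.rec (next 0 0 0, 0)
    (fun k u => (next (k + 1) u.1 (u.2 + X k u.1), u.2 + X k u.1)) k
  have hs : ∀ k, s (k + 1) =
      (next (k + 1) (s k).1 ((s k).2 + X k (s k).1), (s k).2 + X k (s k).1) := fun _ => rfl
  have hsum : ∀ k, (s k).2 = ∑ l ∈ Finset.range k, X l (s l).1 := by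
    intro k
    induction k with
    | zero => rfl
    | succ k ih => rw [Finset.sum_range_succ, ← ih, hs]
  refine ⟨fun k => (s k).1, strictMono_nat_of_lt_succ fun k => ?_, fun k => ?_⟩
  · rw [hs]
    exact h1 _ _ _
  · rw [← hsum]
    cases k with
    | zero => exact h2 0 0 0
    | succ k =>
      rw [hs]
      exact h2 _ _ _

theorem tendsto_M_rpow_atTop (hm : ∀ k, 2 ≤ m k) {e : ℝ} (he : 0 < e) :
    Tendsto (fun n => (M m n : ℝ) ^ e) atTop atTop :=
  (tendsto_rpow_atTop he).comp (tendsto_natCast_atTop_atTop.comp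
    (tendsto_atTop_mono (fun n => (lt_M hm n).le) tendsto_id))

/-- For `p < 1/2` the `T` means are not uniformly bounded in weak `L_p` on some element of
`H_p`. -/
theorem exists_memHardy_iSup_weakNorm_eq_top (hm : ∀ k, 2 ≤ m k)
    (hm_bdd : BddAbove (Set.range m)) {q : ℕ → ℝ} (hq0 : ∀ k, 0 ≤ q k) (hqpos : 0 < q 0)
    {p : ℝ} (hp : 0 < p) (hp2 : p < 1 / 2) {c : ℝ} (hc : 0 < c)
    (hqc : ∀ n : ℕ, 1 ≤ n → c / (n : ℝ) ≤ q (n + 1) / Q q (n + 2)) :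
    ∃ f : ℕ → G m → ℂ, MemHardy m p f ∧ (⨆ n : ℕ, weakNorm m p (tMean m q f n)) = ∞ := by
  have : ∀ k, NeZero (m k) := fun k => ⟨by have := hm k; omega⟩
  obtain ⟨b, hb'⟩ := hm_bdd
  have hb : ∀ k, m k ≤ b := fun k => hb' ⟨k, rfl⟩
  have hM : ∀ n, (0 : ℝ) < M m n := fun n => by exact_mod_cast M_pos n
  -- The exponent makes `(v M)^p / M` equal to `2^{-kp}`, which is summable, while the weight `c /
  -- M` leaves `c 2^{-k} M^{1/p - 2}`, unbounded in `M` since `p < 1/2`.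
  let v : ℕ → ℕ → ℝ := fun k a => (1 / 2) ^ k * (M m a : ℝ) ^ (1 / p - 1)
  have hv : ∀ k a, 0 < v k a := fun k a => by
    have := hM a
    positivity
  have he : 0 < 1 / p - 2 := by
    rw [sub_pos, lt_div_iff₀ hp]
    linarith
  obtain ⟨α, hα, hle⟩ := exists_strictMono_add_sum_le (fun l a => v l a * M m (a + 1))
    (fun k a => c * (1 / 2) ^ k * (M m a : ℝ) ^ (1 / p - 2))
    (fun k => (tendsto_M_rpow_atTop hm he).const_mul_atTop (by positivity))
  -- Blocks outside the sparse sequence carry the coefficient `0`.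
  let β : ℕ → ℝ := Function.extend α (fun k => v k (α k)) 0
  have hβα : ∀ k, β (α k) = v k (α k) := fun k => hα.injective.extend_apply _ _ k
  have hβ' : ∀ n, n ∉ Set.range α → β n = 0 := fun n hn =>
    Function.extend_apply' _ _ n fun ⟨k, hk⟩ => hn ⟨k, hk⟩
  have hβ : ∀ n, 0 ≤ β n := by
    intro n
    by_cases hn : n ∈ Set.range α
    · obtain ⟨k, rfl⟩ := hn
      rw [hβα]
      exact (hv _ _).le
    · rw [hβ' n hn]
  have hsum : ∑' n, ENNReal.ofReal ((β n * M m n) ^ p * (M m n : ℝ)⁻¹) < ∞ := by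
    have hsupp : Function.support (fun n => ENNReal.ofReal ((β n * M m n) ^ p * (M m n : ℝ)⁻¹)) ⊆
        Set.range α := by
      intro n hn
      by_contra hn'
      refine hn ?_
      simp [hβ' n hn', Real.zero_rpow hp.ne']
    rw [← hα.injective.tsum_eq hsupp]
    have hterm : ∀ k, (β (α k) * M m (α k)) ^ p * (M m (α k) : ℝ)⁻¹ = ((1 / 2 : ℝ) ^ p) ^ k := by
      intro k
      have hMk := hM (α k)
      have h1 : β (α k) * M m (α k) = (1 / 2) ^ k * (M m (α k) : ℝ) ^ (1 / p) := by
        rw [hβα, mul_assoc, ← Real.rpow_add_one hMk.ne', sub_add_cancel]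
      rw [h1, Real.mul_rpow (by positivity) (by positivity), ← Real.rpow_mul hMk.le,
        one_div_mul_cancel hp.ne', Real.rpow_one, mul_assoc, mul_inv_cancel₀ hMk.ne', mul_one,
        ← Real.rpow_natCast_mul (by norm_num), mul_comm, Real.rpow_mul_natCast (by norm_num)]
    simp only [hterm]
    exact (summable_geometric_of_lt_one (by positivity)
      (Real.rpow_lt_one (by norm_num) (by norm_num) hp)).tsum_ofReal_lt_top
  refine ⟨blockMartingale m β, ⟨martingale_blockMartingale hm β,
    hardyNorm_blockMartingale_lt_top hm hb hβ hp (by linarith) hsum⟩, ?_⟩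
  have hlow : ∀ (k : ℕ) (x : G m), (k + 2 : ℝ) ≤
      ‖tMean m q (blockMartingale m β) (M m (α k) + 2) x‖ := by
    intro k x
    have hMk := hM (α k)
    have h1 := le_norm_tMean (blockMartingale m β) hq0 hqpos (M m (α k)) x
    have h2 := sum_norm_coeff_blockMartingale_le hm hβ (α k)
    have h3 : ‖coeff m (blockMartingale m β) (M m (α k))‖ = v k (α k) := by
      rw [coeff_blockMartingale hm β le_rfl (by
        have := two_mul_M_le hm (α k); have := M_pos (m := m) (α k); omega), hβα,
        Complex.norm_real, Real.norm_of_nonneg (hv _ _).le]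
    have h4 : ∑ n ∈ Finset.range (α k), β n * M m (n + 1) =
        ∑ l ∈ Finset.range k, v l (α l) * M m (α l + 1) := by
      simp only [← hβα]
      rw [← Finset.sum_image (s := Finset.range k) (g := α) (f := fun n => β n * M m (n + 1))
        hα.injective.injOn]
      symm
      refine Finset.sum_subset ?_ fun n hn hn' => ?_
      · intro n hn
        obtain ⟨l, hl, rfl⟩ := Finset.mem_image.1 hn
        exact Finset.mem_range.2 (hα (Finset.mem_range.1 hl))
      · rw [hβ' n, zero_mul]
        rintro ⟨l, rfl⟩
        exact hn' (Finset.mem_image_of_mem _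
          (Finset.mem_range.2 (hα.lt_iff_lt.1 (Finset.mem_range.1 hn))))
    have h5 : c * (1 / 2) ^ k * (M m (α k) : ℝ) ^ (1 / p - 2) ≤
        q (M m (α k) + 1) / Q q (M m (α k) + 2) * v k (α k) := by
      refine le_trans (le_of_eq ?_) (mul_le_mul_of_nonneg_right (hqc _ (M_pos _)) (hv _ _).le)
      simp only [v]
      rw [show 1 / p - 1 = (1 / p - 2) + 1 by ring, Real.rpow_add_one hMk.ne']
      field_simp
    have h6 := hle k
    rw [h3] at h1
    linarith
  rw [iSup_eq_top]
  intro B hB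
  obtain ⟨k, hk⟩ := ENNReal.exists_nat_gt hB.ne
  refine ⟨M m (α k) + 2, hk.trans_le ?_⟩
  -- The lower bound `k + 2` holds at every point, so the strict level set at `k + 1` is the whole
  -- group, of measure one.
  have h1 := le_weakNorm (m := m) hp (t := (k + 1 : ℝ≥0)) (by positivity)
    (g := tMean m q (blockMartingale m β) (M m (α k) + 2)) fun x => by
      have := hlow k x
      push_cast
      linarith
  refine le_trans ?_ h1
  push_cast
  exact le_self_add

end Lacunary

end Vilenkin

end

theorem theorem1 (m : ℕ → ℕ) (hm : ∀ k, 2 ≤ m k) (hm_bdd : BddAbove (Set.range m))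
    (q : ℕ → ℝ) (hq_nonneg : ∀ k, 0 ≤ q k) (hq_zero : 0 < q 0) (hq : Antitone q) :
    (∃ C : ℝ≥0, ∀ f : ℕ → Vilenkin.G m → ℂ, Vilenkin.MemHardy m (1 / 2) f →
      Vilenkin.weakNorm m (1 / 2) (Vilenkin.tMax m q f) ≤
        (C : ℝ≥0∞) * Vilenkin.hardyNorm m (1 / 2) f) ∧
    (∀ p : ℝ, 0 < p → p < 1 / 2 → ∀ c : ℝ, 0 < c →
      (∀ n : ℕ, 1 ≤ n → c / (n : ℝ) ≤ q (n + 1) / Vilenkin.Q q (n + 2)) →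
      ∃ f : ℕ → Vilenkin.G m → ℂ, Vilenkin.MemHardy m p f ∧
        (⨆ n : ℕ, Vilenkin.weakNorm m p (Vilenkin.tMean m q f n)) = ∞) := by
  exact ⟨Vilenkin.exists_weakNorm_tMax_le hm hm_bdd hq_nonneg hq_zero hq,
    fun _ hp hp2 _ hc hqc => Vilenkin.exists_memHardy_iSup_weakNorm_eq_top hm hm_bdd hq_nonneg
      hq_zero hp hp2 hc hqc⟩
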